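/- Let $A_i$, $i=1,\dots,5$, be five points of the Euclidean plane, subscripts being taken modulo $5$. For each $i$, let $B_{i+3}$ be the intersection of the lines $A_iA_{i+1}$ and $A_{i+2}A_{i+3}$, let $K_{i+2}$ be the centre of the circle $(A_iA_{i+1}B_{i+2})$, let $C_{i+1}$ be the second intersection of the circles $(A_iA_{i+1}B_{i+2})$ and $(A_{i+1}A_{i+2}B_{i+3})$, and let $L_i$ be the centre of the circle $(C_{i+1}B_{i+2}B_{i+3})$. Assume that the five centres $K_i$ lie on the circle $(O)$, with centre $O$, that passes through the five points $C_i$. For each $i$, let $D_i$ be the intersection of the lines $K_iK_{i+2}$ and $K_{i+1}K_{i+3}$, and let $E_i$ be the second intersection of the circles $(D_iD_{i+1}K_{i+2})$ and $(D_{i+1}D_{i+2}K_{i+3})$, which meet at $D_{i+1}$. (All these intersections and circles are assumed to exist: the lines meet in exactly one point, the triangles are nondegenerate, and the two circles in each pair are distinct; the second intersection of two tangent circles is their point of contact.) Then: 1. for each $i$, the points $K_i$, $L_i$, $E_i$ are collinear; 2. if the points $E_i$ do not all lie on a line, $K_i\neq L_i$ for all $i$, and the five lines $K_iL_i$ are not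 all parallel, then the points $E_i$ lie on a circle with some centre $J$, the lines $K_iL_i$ are concurrent at a point $X$, and $O$, $J$, $X$ are collinear. -/

import Mathlib

/-- The Euclidean plane. -/
abbrev Plane : Type := EuclideanSpace ℝ (Fin 2)

/-- `p` is the intersection of the lines `ab` and `cd`: both are genuine lines, and `p` is their
only common point. -/
def IsLineIntersection (a b c d p : Plane) : Prop :=
  a ≠ b ∧ c ≠ d ∧ (line[ℝ, a, b] : Set Plane) ∩ (line[ℝ, c, d] : Set Plane) = {p}

/-- `S` is the circle `(abc)`, the circumcircle of the nondegenerate triangle `abc`. -/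
def IsCircle (S : EuclideanGeometry.Sphere Plane) (a b c : Plane) : Prop :=
  AffineIndependent ℝ ![a, b, c] ∧ a ∈ S ∧ b ∈ S ∧ c ∈ S

/-- The circles `S` and `T` meet at `a`, and `c` is their second intersection: they have no common
points except `a` and `c`. (For circles tangent at `a`, the second intersection is `a` itself.) -/
def IsSecondIntersection (S T : EuclideanGeometry.Sphere Plane) (a c : Plane) : Prop :=
  (S : Set Plane) ∩ (T : Set Plane) = {a, c}

/-! Take `O` as origin and `(O)` as unit circle of ℂ, so that conjugation inverts every `K i` and `C
i` and each incidence becomes a rational identity. `A i` is the mirror image of `C i` in the chord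
`K (i+1) K (i+2)`. The two star lines through `B j` give two formulas for `B j`; eliminating it
leaves a cyclic system for the ratios `t j = (K j - C (j+4)) / (C (j+3) - K j)`, which are square
roots of `C (j+4) / C (j+3)`. The product of all `t j` has square 1 and cube -1, hence is -1, and
the system has one solution (`ratio_eq_of_cyclic_system`). So `C`, then `B` and `L`, are rational
functions of the five `K i` (`C_eq`, `B_eq`, `L_eq`).

The points `D` and `E` depend on the `K i` alone (`D_mul`, `E_eq`). The vectors `L i - K i` and `E i
- K i` turn out to have the same quotient by their conjugates, which is the first claim
(`para_K_L_E`).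

For the second, the lines `K i L i` pass through `X = commonNum / commonDen`; a zero denominator
would make them all parallel. The decisive fact (`exists_inversion`) is that `(E i - X) * (conj (K
i) - conj X)` is one real number `p` for all `i`: the `E i` are images of the `K i` under a single
inversion with centre `X` and power `p`. It takes the unit circle to a circle centred on the line `O
X`, unless `X` is on the unit circle, and then the `E i` are collinear. -/

open ComplexConjugate EuclideanGeometry

/-! ### Lines and parallelism in a complex chart -/

/-- Two complex numbers are parallel when they are linearly dependent as plane vectors. -/
def Para (u v : ℂ) : Prop := u * conj v = conj u * v

theorem para_iff_exists_real {u v : ℂ} (hv : v ≠ 0) : Para u v ↔ ∃ t : ℝ, u = t * v := by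
  have hv' : conj v ≠ 0 := by simpa using hv
  constructor
  · intro h
    have h1 : conj (u / v) = u / v := by
      rw [map_div₀, div_eq_div_iff hv' hv]
      exact h.symm
    obtain ⟨t, ht⟩ := Complex.conj_eq_iff_real.1 h1
    exact ⟨t, by rw [← ht]; field_simp⟩
  · rintro ⟨t, rfl⟩
    simp only [Para, map_mul, Complex.conj_ofReal]
    ring

/-- An affine chart of the plane in which the circle of centre `O` and radius `r` becomes the unit
circle. -/
theorem exists_affineEquiv_complex (O : Plane) {r : ℝ} (hr : 0 < r) :
    ∃ f : Plane ≃ᵃ[ℝ] ℂ, f O = 0 ∧ ∀ p q, dist (f p) (f q) = r⁻¹ * dist p q := by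
  let φ : Plane ≃ₗᵢ[ℝ] ℂ := Complex.orthonormalBasisOneI.repr.symm
  have hr' : r⁻¹ ≠ 0 := inv_ne_zero hr.ne'
  refine ⟨(AffineEquiv.vaddConst ℝ O).symm.trans
    (φ.toLinearEquiv.trans (LinearEquiv.smulOfNeZero ℝ ℂ r⁻¹ hr')).toAffineEquiv, by simp, ?_⟩
  intro p q
  simp only [AffineEquiv.coe_trans, Function.comp_apply, 
    LinearEquiv.coe_toAffineEquiv, LinearEquiv.trans_apply, LinearEquiv.smulOfNeZero_apply]
  rw [dist_smul₀, Real.norm_of_nonneg (inv_pos.2 hr).le]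
  congr 1
  rw [LinearIsometryEquiv.coe_toLinearEquiv, φ.dist_map]
  exact dist_vsub_cancel_right p q O

section chart
variable (f : Plane ≃ᵃ[ℝ] ℂ)

theorem mem_line_iff_para {a b p : Plane} (hab : a ≠ b) :
    p ∈ line[ℝ, a, b] ↔ Para (f p - f a) (f b - f a) := by
  have h : f b - f a ≠ 0 := sub_ne_zero.2 fun h => hab (f.injective h).symm
  rw [para_iff_exists_real h, mem_affineSpan_pair_iff_exists_lineMap_eq]
  refine exists_congr fun t => ?_
  rw [← f.injective.eq_iff, ← AffineEquiv.coe_toAffineMap, AffineMap.apply_lineMap,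
    AffineMap.lineMap_apply]
  simp only [AffineEquiv.coe_toAffineMap, vsub_eq_sub, vadd_eq_add, Complex.real_smul]
  constructor
  · intro h
    rw [← h]; ring
  · intro h
    rw [← h]; ring

theorem collinear_iff_para {a b c : Plane} :
    Collinear ℝ {a, b, c} ↔ Para (f b - f a) (f c - f a) := by
  by_cases hab : a = c
  · subst hab
    have h : ({a, b, a} : Set Plane) = {a, b} := by
      ext; simp only [Set.mem_insert_iff, Set.mem_singleton_iff]; tauto
    rw [h]
    exact iff_of_true (collinear_pair ℝ a b) (by simp [Para])
  · have h : ({a, b, c} : Set Plane) = {b, a, c} := Set.insert_comm _ _ _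
    rw [← mem_line_iff_para f hab, h]
    constructor
    · intro hc
      exact hc.mem_affineSpan_of_mem_of_ne (by simp) (by simp) (by simp) hab
    · exact collinear_insert_of_mem_affineSpan_pair

theorem IsLineIntersection.para_left {a b c d p : Plane} (h : IsLineIntersection a b c d p) :
    Para (f p - f a) (f b - f a) :=
  (mem_line_iff_para f h.1).1 (h.2.2.symm.subset rfl).1

theorem IsLineIntersection.para_right {a b c d p : Plane} (h : IsLineIntersection a b c d p) :
    Para (f p - f c) (f d - f c) :=
  (mem_line_iff_para f h.2.1).1 (h.2.2.symm.subset rfl).2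

theorem IsLineIntersection.not_para {a b c d p : Plane} (h : IsLineIntersection a b c d p) :
    ¬ Para (f b - f a) (f d - f c) := by
  intro hp
  have h1 := h.para_left f
  have h2 := h.para_right f
  have hab : f b - f a ≠ 0 := sub_ne_zero.2 fun e => h.1 (f.injective e).symm
  -- Were the directions parallel, `p` moved by `b - a` would be a second common point.
  let q := f.symm (f p + (f b - f a))
  have hq : f q = f p + (f b - f a) := f.apply_symm_apply _
  have hmem : q ∈ (line[ℝ, a, b] : Set Plane) ∩ (line[ℝ, c, d] : Set Plane) := by
    refine ⟨(mem_line_iff_para f h.1).2 ?_, (mem_line_iff_para f h.2.1).2 ?_⟩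
    · unfold Para at *
      rw [hq]
      simp only [map_sub, map_add] at *
      linear_combination h1
    · unfold Para at *
      rw [hq]
      simp only [map_sub, map_add] at *
      linear_combination h2 + hp
  rw [h.2.2] at hmem
  have : f q = f p := by rw [Set.mem_singleton_iff.1 hmem]
  rw [hq] at this
  exact hab (by linear_combination this)

theorem parallel_of_para {a b c d : Plane} (hab : a ≠ b) (hcd : c ≠ d)
    (h : Para (f b - f a) (f d - f c)) : (line[ℝ, a, b]).Parallel (line[ℝ, c, d]) := by
  have hab' : f b - f a ≠ 0 := sub_ne_zero.2 fun e => hab (f.injective e).symm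
  have hcd' : f d - f c ≠ 0 := sub_ne_zero.2 fun e => hcd (f.injective e).symm
  obtain ⟨t, ht⟩ := (para_iff_exists_real hcd').1 h
  have ht0 : t ≠ 0 := by
    rintro rfl
    exact hab' (by simpa using ht)
  have key : b -ᵥ a = t • (d -ᵥ c) := by
    apply f.linear.injective
    have hl : ∀ p q : Plane, f.linear (p -ᵥ q) = f p - f q := fun p q =>
      f.toAffineMap.linearMap_vsub p q
    rw [map_smul, hl, hl, ht, Complex.real_smul]
  rw [AffineSubspace.affineSpan_pair_parallel_iff_vectorSpan_eq, vectorSpan_pair_rev,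
    vectorSpan_pair_rev, key]
  exact Submodule.span_singleton_smul_eq (IsUnit.mk0 t ht0) _

theorem IsCircle.not_para {S : Sphere Plane} {a b c : Plane} (h : IsCircle S a b c) :
    ¬ Para (f b - f a) (f c - f a) := by
  rw [← collinear_iff_para]
  exact affineIndependent_iff_not_collinear_set.1 h.1

end chart

/-! ### Circles and their second intersections -/

theorem dist_eq_dist_iff_mul_conj {a b c d : ℂ} :
    dist a b = dist c d ↔ (a - b) * conj (a - b) = (c - d) * conj (c - d) := by
  rw [dist_eq_norm, dist_eq_norm, Complex.mul_conj, Complex.mul_conj, Complex.ofReal_inj,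
    Complex.normSq_eq_norm_sq, Complex.normSq_eq_norm_sq,
    pow_left_inj₀ (norm_nonneg _) (norm_nonneg _) two_ne_zero]

/-- Two points equidistant from each of two distinct centres are equal or symmetric in the line of
centres. -/
theorem eq_or_reflection {o o' a c : ℂ}
    (h : (a - o) * conj (a - o) = (c - o) * conj (c - o))
    (h' : (a - o') * conj (a - o') = (c - o') * conj (c - o')) :
    c = a ∨ (c - o) * conj (o' - o) = conj (a - o) * (o' - o) := by
  have key : (c - a) * ((c - o) * conj (o' - o) - conj (a - o) * (o' - o)) = 0 := by
    simp only [map_sub] at *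
    linear_combination (-c + o') * h + (c - o) * h'
  rcases mul_eq_zero.1 key with h1 | h1
  · exact Or.inl (sub_eq_zero.1 h1)
  · exact Or.inr (sub_eq_zero.1 h1)

theorem mul_conj_eq_of_mem {f : Plane ≃ᵃ[ℝ] ℂ} {s : ℝ}
    (hf : ∀ p q, dist (f p) (f q) = s * dist p q)
    {S : Sphere Plane} {a b : Plane} (ha : a ∈ S) (hb : b ∈ S) :
    (f a - f S.center) * conj (f a - f S.center) = (f b - f S.center) * conj (f b - f S.center) := by
  rw [← dist_eq_dist_iff_mul_conj, hf, hf, mem_sphere.1 ha, mem_sphere.1 hb]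

theorem mem_of_mul_conj_eq {f : Plane ≃ᵃ[ℝ] ℂ} {s : ℝ} (hs : s ≠ 0)
    (hf : ∀ p q, dist (f p) (f q) = s * dist p q)
    {S : Sphere Plane} {a b : Plane} (ha : a ∈ S)
    (h : (f a - f S.center) * conj (f a - f S.center)
      = (f b - f S.center) * conj (f b - f S.center)) : b ∈ S := by
  rw [← dist_eq_dist_iff_mul_conj, hf, hf] at h
  rw [mem_sphere, ← mem_sphere.1 ha]
  exact (mul_left_cancel₀ hs h).symm

/-- Concentric circles with a common point coincide; `S` would then be `{a, c}`, too small to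
contain a nondegenerate triangle. -/
theorem IsSecondIntersection.center_ne (f : Plane ≃ᵃ[ℝ] ℂ) {S T : Sphere Plane} {a c x y z : Plane}
    (h : IsSecondIntersection S T a c) (hS : IsCircle S x y z) : T.center ≠ S.center := by
  intro he
  have ha : a ∈ (S : Set Plane) ∩ (T : Set Plane) := h.symm.subset (by simp)
  have hr : T.radius = S.radius := by
    rw [← mem_sphere.1 ha.1, ← mem_sphere.1 ha.2, he]
  have hST : T = S := by
    cases S; cases T; simp_all
  rw [hST, IsSecondIntersection, Set.inter_self] at h
  have h' : (S : Set Plane) = {a, c} := h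
  have hx : x ∈ (S : Set Plane) := hS.2.1
  have hy : y ∈ (S : Set Plane) := hS.2.2.1
  have hz : z ∈ (S : Set Plane) := hS.2.2.2
  rw [h'] at hx hy hz
  have h1 := hS.not_para f
  simp only [Set.mem_insert_iff, Set.mem_singleton_iff] at hx hy hz
  apply h1
  unfold Para
  simp only [map_sub]
  rcases hx with rfl | rfl <;> rcases hy with rfl | rfl <;> rcases hz with rfl | rfl <;> ring

theorem IsSecondIntersection.reflection {f : Plane ≃ᵃ[ℝ] ℂ} {s : ℝ} (hs : s ≠ 0)
    (hf : ∀ p q, dist (f p) (f q) = s * dist p q)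
    {S T : Sphere Plane} {a c : Plane}
    (h : IsSecondIntersection S T a c) (hne : T.center ≠ S.center) :
    (f c - f S.center) * conj (f T.center - f S.center) =
      conj (f a - f S.center) * (f T.center - f S.center) := by
  have ha : a ∈ (S : Set Plane) ∩ (T : Set Plane) := h.symm.subset (by simp)
  have hc : c ∈ (S : Set Plane) ∩ (T : Set Plane) := h.symm.subset (by simp)
  have hne' : f T.center ≠ f S.center := fun e => hne (f.injective e)
  have hd : conj (f T.center) - conj (f S.center) ≠ 0 := by
    rw [← map_sub]
    exact (map_ne_zero _).2 (sub_ne_zero.2 hne')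
  have hd' : f T.center - f S.center ≠ 0 := sub_ne_zero.2 hne'
  rcases eq_or_reflection (mul_conj_eq_of_mem hf ha.1 hc.1)
    (mul_conj_eq_of_mem hf ha.2 hc.2) with hca | hca
  · have hca' : c = a := f.injective hca
    subst hca'
    -- Tangent case: the mirror image `w` of `a` in the line of centres is on both circles, so it
    -- must be `a` itself.
    let w : ℂ := f S.center + conj (f c - f S.center) * (f T.center - f S.center)
      / conj (f T.center - f S.center)
    obtain ⟨q, hq⟩ : ∃ q, f q = w := ⟨f.symm w, f.apply_symm_apply w⟩
    have hmem : q ∈ (S : Set Plane) ∩ (T : Set Plane) := by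
      constructor
      · refine mem_of_mul_conj_eq hs hf ha.1 ?_
        rw [hq]
        simp only [w, map_sub, map_add, map_mul, map_div₀, Complex.conj_conj]
        field_simp
        ring
      · refine mem_of_mul_conj_eq hs hf ha.2 ?_
        rw [hq]
        simp only [w, map_sub, map_add, map_mul, map_div₀, Complex.conj_conj]
        field_simp
        ring
    rw [h] at hmem
    have hqc : q = c := by simpa using hmem
    rw [hqc] at hq
    have e := sub_eq_iff_eq_add'.2 hq
    rwa [eq_div_iff (by simpa using hd)] at e
  · exact hca

/-! ### Star vertices and ratios of consecutive points `C` -/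

/-- The second common point of two circles centred at points `k`, `k'` of the unit
circle, given that the first common point `c` is on the unit circle. -/
theorem eq_of_reflection_of_unit {k k' a c : ℂ} (hk : conj k = k⁻¹) (hk' : conj k' = k'⁻¹)
    (hc : conj c = c⁻¹) (k0 : k ≠ 0) (k0' : k' ≠ 0) (c0 : c ≠ 0) (hne : k' ≠ k)
    (h : (c - k) * conj (k' - k) = conj (a - k) * (k' - k)) : a = k + k' - k * k' / c := by
  have h1 := congrArg conj h
  simp only [map_mul, map_sub, Complex.conj_conj, hk, hk', hc, map_inv₀, inv_inv] at h1
  have h2 : k' - k ≠ 0 := sub_ne_zero.2 hne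
  field_simp at h1
  have h3 := mul_left_cancel₀ h2
    (show (k' - k) * (c * a) = (k' - k) * (c * (k + k') - k * k') by linear_combination h1)
  field_simp
  linear_combination h3

/-- If a line meets two circles with a common point `a` again at `b` and `e`, the rotations about
the centres taking `a` to `b` and `e` satisfy the inscribed angle relation. -/
theorem second_chord_relation {o o' a b e : ℂ}
    (hb : (b - o) * conj (b - o) = (a - o) * conj (a - o))
    (he : (e - o') * conj (e - o') = (a - o') * conj (a - o'))
    (ha : a ≠ o) (hba : b ≠ a) (hea : e ≠ a) (hp : Para (b - a) (e - a)) :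
    (b - o) * conj (a - o') = conj (a - o) * (e - o') := by
  have h1 : (b - a) * (e - a) * (conj (a - o') * (a - o) - conj (b - o) * (e - o')) = 0 := by
    unfold Para at hp
    simp only [map_sub] at *
    linear_combination -(e - o') * (a - o) * hp + (b - a) * (a - o) * he - (e - a) * (e - o') * hb
  have h2 : conj (a - o') * (a - o) = conj (b - o) * (e - o') := by
    have := (mul_eq_zero.1 h1).resolve_left
      (mul_ne_zero (sub_ne_zero.2 hba) (sub_ne_zero.2 hea))
    exact sub_eq_zero.1 this
  apply mul_left_cancel₀ (sub_ne_zero.2 ha)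
  linear_combination (b - o) * h2 + (e - o') * hb

/-- The position of a vertex `b` of the star, in terms of three consecutive centres `l`, `m`, `k`
and the common points `q`, `p` of consecutive circles on the unit circle. -/
theorem star_vertex_relation {k m l p q b a e : ℂ} (hk : conj k = k⁻¹) (hm : conj m = m⁻¹)
    (hp : conj p = p⁻¹) (k0 : k ≠ 0) (m0 : m ≠ 0) (p0 : p ≠ 0) (q0 : q ≠ 0)
    (pk : p ≠ k) (ha : a = m + k - m * k / p) (he : e = l + m - l * m / q)
    (hb : (b - k) * conj (b - k) = (a - k) * conj (a - k))
    (hem : (e - m) * conj (e - m) = (a - m) * conj (a - m))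
    (hba : b ≠ a) (hea : e ≠ a) (hpar : Para (b - a) (e - a)) :
    (b - k) * (m - p) * q = l * (k - p) * (q - m) := by
  have hak : a ≠ k := by
    intro h
    apply pk
    rw [ha] at h
    field_simp at h
    exact mul_left_cancel₀ m0 (by linear_combination h)
  have h := second_chord_relation hb hem hak hba hea hpar
  rw [ha, he] at h
  simp only [map_sub, map_add, map_div₀, map_mul, hk, hm, hp] at h
  field_simp at h
  linear_combination h

theorem Para.sub_sub {a b e : ℂ} (h : Para (b - e) (a - e)) : Para (b - a) (e - a) := by
  unfold Para at *
  simp only [map_sub] at *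
  linear_combination -h

/-- Points `p`, `q` of the unit circle equidistant from a point `k` of it are equal or symmetric
about the diameter through `k`; in both cases `(k - q) / (p - k)` is a square root of `q / p`. -/
theorem ratio_of_equidistant {k p q : ℂ} (hk : conj k = k⁻¹) (hp : conj p = p⁻¹)
    (hq : conj q = q⁻¹) (k0 : k ≠ 0) (p0 : p ≠ 0) (q0 : q ≠ 0) (pk : p ≠ k)
    (h : (p - k) * conj (p - k) = (q - k) * conj (q - k)) :
    ((k - q) / (p - k)) ^ 2 * p = q ∧
      ((k - q) / (p - k) = -1 ∨ (k - q) / (p - k) * p = k) := by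
  have h1 : p - k ≠ 0 := sub_ne_zero.2 pk
  simp only [map_sub, hk, hp, hq] at h
  have key : (p - q) * (p * q - k ^ 2) = 0 := by
    field_simp at h
    linear_combination -h
  rcases mul_eq_zero.1 key with e | e
  · have e' : q = p := (sub_eq_zero.1 e).symm
    subst e'
    have : (k - q) / (q - k) = -1 := by rw [div_eq_iff h1]; ring
    rw [this]
    exact ⟨by ring, Or.inl rfl⟩
  · have e' : (k - q) / (p - k) * p = k := by
      field_simp
      linear_combination -e
    refine ⟨?_, Or.inr e'⟩
    apply mul_left_cancel₀ p0
    rw [show p * (((k - q) / (p - k)) ^ 2 * p) = ((k - q) / (p - k) * p) ^ 2 by ring, e']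
    linear_combination -e

/-! ### The cyclic system for the ratios -/

theorem zmod_five_add :
    (1 : ZMod 5) + 1 = 2 ∧ (1 : ZMod 5) + 2 = 3 ∧ (1 : ZMod 5) + 3 = 4 ∧ (1 : ZMod 5) + 4 = 0 ∧
    (2 : ZMod 5) + 1 = 3 ∧ (2 : ZMod 5) + 2 = 4 ∧ (2 : ZMod 5) + 3 = 0 ∧ (2 : ZMod 5) + 4 = 1 ∧
    (3 : ZMod 5) + 1 = 4 ∧ (3 : ZMod 5) + 2 = 0 ∧ (3 : ZMod 5) + 3 = 1 ∧ (3 : ZMod 5) + 4 = 2 ∧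
    (4 : ZMod 5) + 1 = 0 ∧ (4 : ZMod 5) + 2 = 1 ∧ (4 : ZMod 5) + 3 = 2 ∧ (4 : ZMod 5) + 4 = 3 := by
  decide

theorem forall_zmod_five {P : ZMod 5 → Prop} : (∀ i, P i) ↔ P 0 ∧ P 1 ∧ P 2 ∧ P 3 ∧ P 4 := by
  constructor
  · exact fun h => ⟨h 0, h 1, h 2, h 3, h 4⟩
  · rintro ⟨h0, h1, h2, h3, h4⟩ i
    fin_cases i
    exacts [h0, h1, h2, h3, h4]

/-- The cyclic system satisfied by the ratios of a five circles configuration has a unique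
solution. -/
theorem ratio_eq_of_cyclic_system {K C t : ZMod 5 → ℂ} (hK : ∀ i, K i ≠ 0) (hC : ∀ i, C i ≠ 0)
    (hsq : ∀ i, t i ^ 2 * C (i + 3) = C (i + 4))
    (ht : ∀ i, t (i + 4) * t i * t (i + 1) * K (i + 3) = -K (i + 2)) (i : ZMod 5) :
    t i * (K (i + 2) * K (i + 4)) = -(K (i + 1) * K (i + 3)) := by
  have key : t 0 * t 1 * t 2 * t 3 * t 4 = -1 := by
    rw [forall_zmod_five] at hK hC hsq ht
    simp only [zmod_five_add, zero_add] at hsq ht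
    obtain ⟨s0, s1, s2, s3, s4⟩ := hsq
    obtain ⟨c0, c1, c2, c3, c4⟩ := hC
    obtain ⟨k0, k1, k2, k3, k4⟩ := hK
    obtain ⟨r0, r1, r2, r3, r4⟩ := ht
    -- The squares telescope once around the cycle of the `C i`; multiplying the five relations `ht`
    -- gives the cube.
    have hT2 : (t 0 * t 1 * t 2 * t 3 * t 4) ^ 2 = 1 := by
      apply mul_right_cancel₀ c3
      linear_combination (t 1 ^ 2 * t 2 ^ 2 * t 3 ^ 2 * t 4 ^ 2) * s0 +
        (t 2 ^ 2 * t 3 ^ 2 * t 4 ^ 2) * s1 + (t 3 ^ 2 * t 4 ^ 2) * s2 + t 4 ^ 2 * s3 + s4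
    have hT3 : (t 0 * t 1 * t 2 * t 3 * t 4) ^ 3 = -1 := by
      have e : (t 4 * t 0 * t 1 * K 3) * (t 0 * t 1 * t 2 * K 4) * (t 1 * t 2 * t 3 * K 0) *
          (t 2 * t 3 * t 4 * K 1) * (t 3 * t 4 * t 0 * K 2) =
          (-K 2) * (-K 3) * (-K 4) * (-K 0) * (-K 1) := by
        rw [r0, r1, r2, r3, r4]
      apply mul_right_cancel₀ (mul_ne_zero (mul_ne_zero (mul_ne_zero (mul_ne_zero k0 k1) k2) k3) k4)
      linear_combination e
    linear_combination hT3 - (t 0 * t 1 * t 2 * t 3 * t 4) * hT2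
  have keyi : t i * t (i + 1) * t (i + 2) * t (i + 3) * t (i + 4) = -1 := by
    revert i
    rw [forall_zmod_five]
    simp only [zmod_five_add, zero_add]
    refine ⟨?_, ?_, ?_, ?_, ?_⟩ <;> linear_combination key
  -- The product of these two relations contains `t i` twice and every other ratio once, so dividing
  -- by the full product isolates `t i`.
  have r1 := ht (i + 1)
  have r4 := ht (i + 4)
  simp only [add_assoc, zmod_five_add, add_zero] at r1 r4
  linear_combination -(t (i + 3) * t (i + 4) * t i * K (i + 2)) * r1 + K (i + 3) * r4 +
    t i * K (i + 2) * K (i + 4) * keyi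

/-- Since `p * q = m ^ 2`, the factor `(m - p) * q` equals `m * (q - m)`, and `q - m` cancels. -/
theorem star_vertex_eq {k m l p q b x y : ℂ} (m0 : m ≠ 0) (l0 : l ≠ 0)
    (x0 : x ≠ 0) (hp : p = -(m * k * y) / (l * x))
    (hpq : p * q = m ^ 2) (qm : q ≠ m)
    (h : (b - k) * (m - p) * q = l * (k - p) * (q - m)) :
    b = k + l * k / m + k * y / x := by
  have h1 : (b - k) * m = l * (k - p) := by
    apply mul_right_cancel₀ (sub_ne_zero.2 qm)
    linear_combination h + (b - k) * hpq
  rw [hp] at h1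
  field_simp at h1 ⊢
  linear_combination h1

/-! ### The centres `L` -/

/-- The equidistance equation is divisible by a nonzero factor of `b - c`; the linear equation that
remains is free of `k₃` and `k₄`. -/
theorem perpendicular_bisector_equation {l c b k₀ k₁ k₂ k₃ k₄ : ℂ}
    (h0 : conj k₀ = k₀⁻¹) (h1 : conj k₁ = k₁⁻¹) (h2 : conj k₂ = k₂⁻¹) (h3 : conj k₃ = k₃⁻¹)
    (h4 : conj k₄ = k₄⁻¹) (n0 : k₀ ≠ 0) (n1 : k₁ ≠ 0) (n2 : k₂ ≠ 0) (n3 : k₃ ≠ 0) (n4 : k₄ ≠ 0)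
    (hc : c = -(k₀ * k₂ * k₃) / (k₁ * k₄)) (hb : b = k₂ + k₀ * k₂ / k₁ + k₂ * k₄ / k₃)
    (hbc : b ≠ c) (h : (c - l) * conj (c - l) = (b - l) * conj (b - l)) :
    k₁ * l + k₀ * k₂ ^ 2 * conj l = k₂ * (k₀ + k₁) := by
  have e : b - c = k₂ * ((k₃ + k₄) * (k₁ * k₄ + k₀ * k₃)) / (k₁ * k₃ * k₄) := by
    rw [hb, hc]; field_simp; ring
  have hne : (k₃ + k₄) * (k₁ * k₄ + k₀ * k₃) ≠ 0 := by
    intro h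
    rw [h] at e
    exact hbc (sub_eq_zero.1 (by simpa using e))
  have hcc : conj c = -(k₁ * k₄) / (k₀ * k₂ * k₃) := by
    rw [hc]; simp only [map_div₀, map_neg, map_mul, h0, h1, h2, h3, h4]; field_simp
  have hcb : conj b = 1 / k₂ + k₁ / (k₀ * k₂) + k₃ / (k₂ * k₄) := by
    rw [hb]; simp only [map_div₀, map_add, map_mul, h0, h1, h2, h3, h4]; field_simp
  simp only [map_sub, hcc, hcb] at h
  rw [hb, hc] at h
  apply mul_left_cancel₀ hne
  field_simp at h ⊢
  linear_combination h

/-- Direction of the line `K L`, with `K` at `k₀`. -/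
def dirKL (k₀ k₁ k₂ k₃ k₄ : ℂ) : ℂ :=
  k₁ * k₂ * k₃ ^ 2 - k₂ ^ 2 * k₃ * k₄ + k₀ * k₂ ^ 2 * k₄ - k₀ * k₁ * k₃ ^ 2
    - k₀ * k₂ * k₃ * (k₂ - k₃)

/-- Up to a monomial, the conjugate of `dirKL`. -/
def dirKLConj (k₀ k₁ k₂ k₃ k₄ : ℂ) : ℂ :=
  k₁ * k₃ ^ 2 - k₂ ^ 2 * k₄ - k₀ * k₁ * k₃ + k₀ * k₂ * k₄ - k₁ * k₃ * k₄ + k₁ * k₂ * k₄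

section unit
variable {k₀ k₁ k₂ k₃ k₄ : ℂ}
    (h0 : conj k₀ = k₀⁻¹) (h1 : conj k₁ = k₁⁻¹) (h2 : conj k₂ = k₂⁻¹) (h3 : conj k₃ = k₃⁻¹)
    (h4 : conj k₄ = k₄⁻¹) (n0 : k₀ ≠ 0) (n1 : k₁ ≠ 0) (n2 : k₂ ≠ 0) (n3 : k₃ ≠ 0) (n4 : k₄ ≠ 0)
include h0 h1 h2 h3 h4 n0 n1 n2 n3 n4

theorem conj_dirKL : conj (dirKL k₀ k₁ k₂ k₃ k₄) * (k₀ * k₁ * k₂ ^ 2 * k₃ ^ 2 * k₄) =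
    dirKLConj k₀ k₁ k₂ k₃ k₄ := by
  simp only [dirKL, dirKLConj, map_sub, map_add, map_mul, map_pow, h0, h1, h2, h3, h4]
  field_simp
  ring

theorem second_centre_eq {l c b b' : ℂ}
    (hc : c = -(k₀ * k₂ * k₃) / (k₁ * k₄)) (hb : b = k₂ + k₀ * k₂ / k₁ + k₂ * k₄ / k₃)
    (hb' : b' = k₃ + k₁ * k₃ / k₂ + k₀ * k₃ / k₄)
    (hp : ¬ Para (b - c) (b' - c)) (hl : (c - l) * conj (c - l) = (b - l) * conj (b - l))
    (hl' : (c - l) * conj (c - l) = (b' - l) * conj (b' - l)) :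
    k₁ * k₃ ^ 2 - k₂ ^ 2 * k₄ ≠ 0 ∧
    (l - k₀) * (k₁ * k₃ ^ 2 - k₂ ^ 2 * k₄) = dirKL k₀ k₁ k₂ k₃ k₄ ∧
    conj (l - k₀) * (k₀ * (k₁ * k₃ ^ 2 - k₂ ^ 2 * k₄)) = -dirKLConj k₀ k₁ k₂ k₃ k₄ := by
  have hbc : b ≠ c := by rintro rfl; simp [Para] at hp
  have hbc' : b' ≠ c := by rintro rfl; simp [Para] at hp
  have e := perpendicular_bisector_equation h0 h1 h2 h3 h4 n0 n1 n2 n3 n4 hc hb hbc hl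
  -- The other bisector comes from the symmetry `k₁ ↔ k₄`, `k₂ ↔ k₃`. The determinant of the two is
  -- `k₁ * k₃ ^ 2 - k₂ ^ 2 * k₄` up to the factor `k₀`; its vanishing would make `b - c` and `b' -
  -- c` parallel.
  have e' := perpendicular_bisector_equation (k₁ := k₄) (k₂ := k₃) (k₃ := k₂) (k₄ := k₁)
    h0 h4 h3 h2 h1 n0 n4 n3 n2 n1 (by rw [hc]; ring) (by rw [hb']; ring) hbc' hl'
  refine ⟨?_, ?_, ?_⟩
  · intro h
    apply hp
    have d : b - c = k₂ * ((k₃ + k₄) * (k₁ * k₄ + k₀ * k₃)) / (k₁ * k₃ * k₄) := by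
      rw [hb, hc]; field_simp; ring
    have d' : b' - c = k₃ * ((k₂ + k₁) * (k₁ * k₄ + k₀ * k₂)) / (k₁ * k₂ * k₄) := by
      rw [hb', hc]; field_simp; ring
    rw [d, d']
    simp only [Para, map_div₀, map_add, map_mul, h0, h1, h2, h3, h4]
    field_simp
    linear_combination -((k₃ + k₄) * (k₁ * k₄ + k₀ * k₃) * (k₂ + k₁) * (k₁ * k₄ + k₀ * k₂)) * h
  · rw [dirKL]
    linear_combination k₃ ^ 2 * e - k₂ ^ 2 * e'
  · rw [map_sub, h0, dirKLConj]
    field_simp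
    linear_combination k₁ * e' - k₄ * e

end unit

/-! ### The pentagram of the `K i`: points `D`, circumcentres, points `E` -/

/-- The chord through unit points `x`, `y` is `z + x * y * conj z = x + y`; eliminating `conj z`
from two such equations gives `z`. -/
theorem chord_intersection {a b c d z : ℂ} (ha : conj a = a⁻¹) (hb : conj b = b⁻¹)
    (hc : conj c = c⁻¹) (hd : conj d = d⁻¹) (a0 : a ≠ 0) (b0 : b ≠ 0) (c0 : c ≠ 0) (d0 : d ≠ 0)
    (hab : a ≠ b) (hcd : c ≠ d) (h : Para (z - a) (b - a)) (h' : Para (z - c) (d - c))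
    (hn : ¬ Para (b - a) (d - c)) :
    a * b - c * d ≠ 0 ∧ z * (a * b - c * d) = a * b * (c + d) - c * d * (a + b) := by
  have chord : ∀ {x y : ℂ}, conj x = x⁻¹ → conj y = y⁻¹ → x ≠ 0 → y ≠ 0 → x ≠ y →
      Para (z - x) (y - x) → z + x * y * conj z = x + y := by
    intro x y hx hy x0 y0 hxy h
    simp only [Para, map_sub, hx, hy] at h
    apply mul_left_cancel₀ (sub_ne_zero.2 hxy)
    field_simp at h
    linear_combination h
  have e := chord ha hb a0 b0 hab h
  have e' := chord hc hd c0 d0 hcd h'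
  constructor
  · intro hz
    apply hn
    simp only [Para, map_sub, ha, hb, hc, hd]
    field_simp
    linear_combination (b - a) * (c - d) * hz
  · linear_combination a * b * e' - c * d * e

/-- The line of the points equidistant from `k` and `k + u`, when `u` is parallel to a chord `g`
of the unit circle. -/
theorem bisector_of_chord {w u g : ℂ} (hu : u ≠ 0) (hg : conj u * g = -u)
    (h : w * conj w = (w - u) * conj (w - u)) : w - g * conj w = u := by
  apply mul_left_cancel₀ hu
  rw [map_sub] at h
  linear_combination -g * h + (w - u) * hg

section unit
variable {k₀ k₁ k₂ k₃ k₄ : ℂ}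
    (h0 : conj k₀ = k₀⁻¹) (h1 : conj k₁ = k₁⁻¹) (h2 : conj k₂ = k₂⁻¹) (h3 : conj k₃ = k₃⁻¹)
    (h4 : conj k₄ = k₄⁻¹) (n0 : k₀ ≠ 0) (n1 : k₁ ≠ 0) (n2 : k₂ ≠ 0) (n3 : k₃ ≠ 0) (n4 : k₄ ≠ 0)
include h0 h1 h2 h3 h4 n0 n1 n2 n3 n4

/-- As `d` is on the chord `k₀ k₂` and `d'` on `k₂ k₄`, `bisector_of_chord` gives two linear
equations for `o - k₂` and its conjugate. -/
theorem pentagram_circumcentre {d d' o m₀ m₁ : ℂ} (h04 : k₀ ≠ k₄)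
    (hm : m₀ ≠ 0) (hm' : m₁ ≠ 0) (e₀ : m₀ = k₀ * k₂ - k₁ * k₃) (e₁ : m₁ = k₁ * k₃ - k₂ * k₄)
    (hd : d * m₀ = k₀ * k₂ * (k₁ + k₃) - k₁ * k₃ * (k₀ + k₂))
    (hd' : d' * m₁ = k₁ * k₃ * (k₂ + k₄) - k₂ * k₄ * (k₁ + k₃))
    (h12 : k₁ ≠ k₂) (h23 : k₂ ≠ k₃)
    (ho : (k₂ - o) * conj (k₂ - o) = (d - o) * conj (d - o))
    (ho' : (k₂ - o) * conj (k₂ - o) = (d' - o) * conj (d' - o)) :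
    o = k₂ + k₀ * k₂ * k₄ * (k₂ - k₁) * (k₂ - k₃) /
      (m₀ * m₁) := by
  have h12' := sub_ne_zero.2 h12
  have h23' := sub_ne_zero.2 h23
  have du : d - k₂ = k₀ * (k₁ - k₂) * (k₂ - k₃) / m₀ := by
    rw [eq_div_iff hm]
    linear_combination hd - k₂ * e₀
  have du' : d' - k₂ = k₄ * (k₂ - k₁) * (k₂ - k₃) / m₁ := by
    rw [eq_div_iff hm']
    linear_combination hd' - k₂ * e₁
  have cm : conj m₀ = -m₀ / (k₀ * k₁ * k₂ * k₃) := by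
    simp only [e₀]; simp only [map_sub, map_mul, h0, h1, h2, h3]; field_simp; ring
  have cm' : conj m₁ = -m₁ / (k₁ * k₂ * k₃ * k₄) := by
    simp only [e₁]; simp only [map_sub, map_mul, h4, h1, h2, h3]; field_simp; ring
  have e := bisector_of_chord (w := o - k₂) (u := d - k₂) (g := k₀ * k₂)
    (by rw [du]; exact div_ne_zero (mul_ne_zero (mul_ne_zero n0 h12') h23') hm)
    (by
      rw [du, map_div₀, cm]
      simp only [map_sub, map_mul, h0, h1, h2, h3]
      field_simp
      ring)
    (by simp only [map_sub] at *; linear_combination ho)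
  have e' := bisector_of_chord (w := o - k₂) (u := d' - k₂) (g := k₂ * k₄)
    (by rw [du']; exact div_ne_zero (mul_ne_zero (mul_ne_zero n4 (by
      rw [← neg_sub]; exact neg_ne_zero.2 h12')) h23') hm')
    (by
      rw [du', map_div₀, cm']
      simp only [map_sub, map_mul, h4, h1, h2, h3]
      field_simp
      ring)
    (by simp only [map_sub] at *; linear_combination ho')
  rw [← sub_eq_iff_eq_add', eq_div_iff (mul_ne_zero hm hm')]
  rw [du] at e
  rw [du'] at e'
  have h04' := sub_ne_zero.2 h04
  apply mul_left_cancel₀ h04'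
  have e2 : (k₀ - k₄) * (o - k₂) = k₀ * (k₄ * (k₂ - k₁) * (k₂ - k₃) / m₁) -
      k₄ * (k₀ * (k₁ - k₂) * (k₂ - k₃) / m₀) := by
    linear_combination k₀ * e' - k₄ * e
  rw [← mul_assoc, e2]
  field_simp
  rw [e₀, e₁]
  ring

/-- `e` is the mirror image of `d` in the line of centres. The difference `o' - o` contains the
factor `dirKL`, which is therefore nonzero. The denominators stay abstract as `m₀`, `m₁`, `m₂` until
the final polynomial identities. -/
theorem pentagram_miquel_point {d o o' e m₀ m₁ m₂ : ℂ}
    (hm₀ : m₀ ≠ 0) (hm₁ : m₁ ≠ 0) (hm₂ : m₂ ≠ 0)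
    (e₀ : m₀ = k₀ * k₂ - k₁ * k₃) (e₁ : m₁ = k₁ * k₃ - k₂ * k₄) (e₂ : m₂ = k₂ * k₄ - k₃ * k₀)
    (h23 : k₂ ≠ k₃)
    (hd : d * m₁ = k₁ * k₃ * (k₂ + k₄) - k₂ * k₄ * (k₁ + k₃))
    (ho : o = k₂ + k₀ * k₂ * k₄ * (k₂ - k₁) * (k₂ - k₃) /
      (m₀ * m₁))
    (ho' : o' = k₃ + k₁ * k₃ * k₀ * (k₃ - k₂) * (k₃ - k₄) /
      (m₁ * m₂))
    (hne : o' ≠ o) (he : (e - o) * conj (o' - o) = conj (d - o) * (o' - o)) :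
    dirKL k₀ k₁ k₂ k₃ k₄ ≠ 0 ∧ dirKLConj k₀ k₁ k₂ k₃ k₄ ≠ 0 ∧
    (e - k₀) * dirKLConj k₀ k₁ k₂ k₃ k₄ = m₁ * (k₀ - k₂) * (k₀ - k₃) := by
  have cm₀ : conj m₀ = -m₀ / (k₀ * k₁ * k₂ * k₃) := by
    simp only [e₀]; simp only [map_sub, map_mul, h0, h1, h2, h3]; field_simp; ring
  have cm₁ : conj m₁ = -m₁ / (k₁ * k₂ * k₃ * k₄) := by
    simp only [e₁]; simp only [map_sub, map_mul, h4, h1, h2, h3]; field_simp; ring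
  have cm₂ : conj m₂ = -m₂ / (k₂ * k₃ * k₄ * k₀) := by
    simp only [e₂]; simp only [map_sub, map_mul, h4, h0, h2, h3]; field_simp; ring
  have cd := conj_dirKL h0 h1 h2 h3 h4 n0 n1 n2 n3 n4
  have hd' : d = k₂ + k₄ * (k₂ - k₁) * (k₂ - k₃) / m₁ := by
    rw [← sub_eq_iff_eq_add', eq_div_iff hm₁]
    linear_combination hd - k₂ * e₁
  have hdo : d - o = -(k₁ * k₃ * k₄ * (k₂ - k₁) * (k₂ - k₃)) /
      (m₀ * m₁) := by
    rw [hd', ho]; field_simp; rw [e₀]; ring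
  have hoo : o' - o = k₁ * k₄ * (k₂ - k₃) * dirKL k₀ k₁ k₂ k₃ k₄ /
      (m₀ * m₁ * m₂) := by
    rw [ho, ho', dirKL]; field_simp; rw [e₀, e₁, e₂]; ring
  have hH : dirKL k₀ k₁ k₂ k₃ k₄ ≠ 0 := by
    intro h
    rw [h] at hoo
    exact hne (sub_eq_zero.1 (by simpa using hoo))
  have hG : dirKLConj k₀ k₁ k₂ k₃ k₄ ≠ 0 := by
    rw [← cd]
    have : conj (dirKL k₀ k₁ k₂ k₃ k₄) ≠ 0 := (map_ne_zero _).2 hH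
    positivity
  refine ⟨hH, hG, ?_⟩
  have cH : conj (dirKL k₀ k₁ k₂ k₃ k₄) =
      dirKLConj k₀ k₁ k₂ k₃ k₄ / (k₀ * k₁ * k₂ ^ 2 * k₃ ^ 2 * k₄) := by
    rw [eq_div_iff (by positivity), cd]
  have cdo : conj (d - o) = k₀ * (k₁ - k₂) * (k₂ - k₃) /
      (m₀ * m₁) := by
    rw [hdo]
    simp only [map_div₀, map_mul, map_neg, cm₀, cm₁]
    simp only [map_sub, h1, h2, h3, h4]
    field_simp
    ring
  have coo : conj (o' - o) = k₀ ^ 2 * k₁ * k₂ ^ 2 * k₃ ^ 2 * k₄ * (k₂ - k₃) *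
      conj (dirKL k₀ k₁ k₂ k₃ k₄) /
      (m₀ * m₁ * m₂) := by
    rw [hoo]
    simp only [map_div₀, map_mul, cm₀, cm₁, cm₂]
    simp only [map_sub, h1, h2, h3, h4]
    field_simp
    ring
  have h23' := sub_ne_zero.2 h23
  rw [coo, cdo, hoo, cH] at he
  have he' : (e - o) * dirKLConj k₀ k₁ k₂ k₃ k₄ * (m₀ * m₁) =
      k₁ * k₄ * (k₁ - k₂) * (k₂ - k₃) * dirKL k₀ k₁ k₂ k₃ k₄ := by
    field_simp at he
    linear_combination he
  apply mul_right_cancel₀ (mul_ne_zero hm₀ hm₁)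
  have ho2 : (o - k₂) * (m₀ * m₁) =
      k₀ * k₂ * k₄ * (k₂ - k₁) * (k₂ - k₃) := by
    rw [ho]; field_simp; ring
  have fin : k₁ * k₄ * (k₁ - k₂) * (k₂ - k₃) * dirKL k₀ k₁ k₂ k₃ k₄ +
      dirKLConj k₀ k₁ k₂ k₃ k₄ * (k₀ * k₂ * k₄ * (k₂ - k₁) * (k₂ - k₃)) +
      (k₂ - k₀) * dirKLConj k₀ k₁ k₂ k₃ k₄ * (m₀ * m₁) =
      m₁ * (k₀ - k₂) * (k₀ - k₃) *
        (m₀ * m₁) := by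
    rw [dirKL, dirKLConj, e₀, e₁]; ring
  linear_combination he' + dirKLConj k₀ k₁ k₂ k₃ k₄ * ho2 + fin

end unit

/-! ### The configuration solved in terms of the `K i` -/

/-- The configuration of the theorem in the complex plane, with the circle `(O)` as the unit circle.
The points `P i` are the centres of the circles through `D i` and `D (i + 1)`. -/
structure StarConfiguration (A B C D E K L P : ZMod 5 → ℂ) : Prop where
  conj_C : ∀ i, conj (C i) = (C i)⁻¹
  conj_K : ∀ i, conj (K i) = (K i)⁻¹
  C_ne_zero : ∀ i, C i ≠ 0
  K_ne_zero : ∀ i, K i ≠ 0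
  A_ne : ∀ i, A i ≠ A (i + 1)
  B_left : ∀ i, Para (B (i + 3) - A i) (A (i + 1) - A i)
  B_right : ∀ i, Para (B (i + 3) - A (i + 2)) (A (i + 3) - A (i + 2))
  A_circle : ∀ i, (A i - K (i + 2)) * conj (A i - K (i + 2)) =
    (A (i + 1) - K (i + 2)) * conj (A (i + 1) - K (i + 2))
  B_circle : ∀ i, (B (i + 2) - K (i + 2)) * conj (B (i + 2) - K (i + 2)) =
    (A i - K (i + 2)) * conj (A i - K (i + 2))
  C_circle : ∀ i, (C i - K (i + 2)) * conj (C i - K (i + 2)) =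
    (A i - K (i + 2)) * conj (A i - K (i + 2))
  C_circle_succ : ∀ i, (C (i + 1) - K (i + 2)) * conj (C (i + 1) - K (i + 2)) =
    (A i - K (i + 2)) * conj (A i - K (i + 2))
  ABA_triangle : ∀ i, ¬ Para (A (i + 1) - A i) (B (i + 2) - A i)
  K_ne : ∀ i, K (i + 3) ≠ K (i + 2)
  C_reflection : ∀ i, (C (i + 1) - K (i + 2)) * conj (K (i + 3) - K (i + 2)) =
    conj (A (i + 1) - K (i + 2)) * (K (i + 3) - K (i + 2))
  L_circle : ∀ i, (C (i + 1) - L i) * conj (C (i + 1) - L i) =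
    (B (i + 2) - L i) * conj (B (i + 2) - L i)
  L_circle' : ∀ i, (C (i + 1) - L i) * conj (C (i + 1) - L i) =
    (B (i + 3) - L i) * conj (B (i + 3) - L i)
  CBB_triangle : ∀ i, ¬ Para (B (i + 2) - C (i + 1)) (B (i + 3) - C (i + 1))
  K_ne' : ∀ i, K i ≠ K (i + 2)
  D_left : ∀ i, Para (D i - K i) (K (i + 2) - K i)
  D_right : ∀ i, Para (D i - K (i + 1)) (K (i + 3) - K (i + 1))
  KK_not_para : ∀ i, ¬ Para (K (i + 2) - K i) (K (i + 3) - K (i + 1))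
  D_circle : ∀ i, (K (i + 2) - P i) * conj (K (i + 2) - P i) = (D i - P i) * conj (D i - P i)
  D_circle_succ : ∀ i, (K (i + 2) - P i) * conj (K (i + 2) - P i) =
    (D (i + 1) - P i) * conj (D (i + 1) - P i)
  P_ne : ∀ i, P (i + 1) ≠ P i
  E_reflection : ∀ i, (E i - P i) * conj (P (i + 1) - P i) =
    conj (D (i + 1) - P i) * (P (i + 1) - P i)

namespace StarConfiguration
variable {A B C D E K L P : ZMod 5 → ℂ} (S : StarConfiguration A B C D E K L P)
include S

theorem A_eq (i : ZMod 5) : A i = K (i + 1) + K (i + 2) - K (i + 1) * K (i + 2) / C i := by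
  have hn := S.K_ne (i + 4)
  have hr := S.C_reflection (i + 4)
  simp only [add_assoc, zmod_five_add, add_zero] at hn hr
  exact eq_of_reflection_of_unit (S.conj_K _) (S.conj_K _) (S.conj_C _) (S.K_ne_zero _)
    (S.K_ne_zero _) (S.C_ne_zero _) hn hr

theorem A_ne_K (i : ZMod 5) : A i ≠ K (i + 2) := by
  intro h
  have h1 := S.A_circle i
  rw [h, sub_self, zero_mul, eq_comm, Complex.mul_conj, Complex.ofReal_eq_zero,
    Complex.normSq_eq_zero, sub_eq_zero] at h1
  exact S.A_ne i (h.trans h1.symm)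

theorem C_ne_K (i : ZMod 5) : C i ≠ K (i + 2) := by
  intro h
  have h1 := S.C_circle i
  rw [h, sub_self, zero_mul, eq_comm, Complex.mul_conj, Complex.ofReal_eq_zero,
    Complex.normSq_eq_zero, sub_eq_zero] at h1
  exact S.A_ne_K i h1

theorem C_succ_ne_K (i : ZMod 5) : C (i + 1) ≠ K (i + 2) := by
  intro h
  have h1 := S.C_circle_succ i
  rw [h, sub_self, zero_mul, eq_comm, Complex.mul_conj, Complex.ofReal_eq_zero,
    Complex.normSq_eq_zero, sub_eq_zero] at h1
  exact S.A_ne_K i h1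

/-- This uses the line `A (j+2) A (j+3)` through `B j`; `right_relation` is the mirror image, from
`A (j+4) A j`. -/
theorem left_relation (j : ZMod 5) : (B j - K j) * (K (j + 4) - C (j + 3)) * C (j + 2) =
    K (j + 3) * (K j - C (j + 3)) * (C (j + 2) - K (j + 4)) := by
  have ha := S.A_eq (j + 3)
  have he := S.A_eq (j + 2)
  have hb := S.B_circle (j + 3)
  have hem := S.A_circle (j + 2)
  have hea := S.A_ne (j + 2)
  have hp := S.B_left (j + 2)
  have ht := S.ABA_triangle (j + 3)
  have hC := S.C_ne_K (j + 3)
  simp only [add_assoc, zmod_five_add, add_zero] at *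
  refine star_vertex_relation (S.conj_K _) (S.conj_K _) (S.conj_C _) (S.K_ne_zero _)
    (S.K_ne_zero _) (S.C_ne_zero _) (S.C_ne_zero _) hC ha he hb hem ?_ hea hp.sub_sub
  intro h
  rw [h] at ht
  exact ht (by simp [Para])

theorem right_relation (j : ZMod 5) : (B j - K j) * (K (j + 1) - C (j + 4)) * C j =
    K (j + 2) * (K j - C (j + 4)) * (C j - K (j + 1)) := by
  have ha := S.A_eq (j + 4)
  have he := S.A_eq j
  have hb := S.B_circle (j + 3)
  have hb' := S.A_circle (j + 3)
  have hem := S.A_circle (j + 4)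
  have hea := S.A_ne (j + 4)
  have hp := S.B_right (j + 2)
  have ht := S.ABA_triangle (j + 3)
  have hC := S.C_succ_ne_K (j + 3)
  simp only [add_assoc, zmod_five_add, add_zero] at *
  refine star_vertex_relation (S.conj_K _) (S.conj_K _) (S.conj_C _) (S.K_ne_zero _)
    (S.K_ne_zero _) (S.C_ne_zero _) (S.C_ne_zero _) hC (by rw [ha]; ring) (by rw [he]; ring)
    (hb.trans hb') hem.symm ?_ hea.symm hp
  intro h
  rw [h] at ht
  exact ht (by simp only [Para]; ring)

theorem ratio_sq (j : ZMod 5) :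
    ((K j - C (j + 4)) / (C (j + 3) - K j)) ^ 2 * C (j + 3) = C (j + 4) ∧
    ((K j - C (j + 4)) / (C (j + 3) - K j) = -1 ∨
      (K j - C (j + 4)) / (C (j + 3) - K j) * C (j + 3) = K j) := by
  have h := (S.C_circle (j + 3)).trans (S.C_circle_succ (j + 3)).symm
  have hC := S.C_ne_K (j + 3)
  simp only [add_assoc, zmod_five_add, add_zero] at h hC
  exact ratio_of_equidistant (S.conj_K _) (S.conj_C _) (S.conj_C _) (S.K_ne_zero _)
    (S.C_ne_zero _) (S.C_ne_zero _) hC h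

theorem ratio_mul (j : ZMod 5) : (K j - C (j + 4)) / (C (j + 3) - K j) *
    (K (j + 2) * K (j + 4)) = -(K (j + 1) * K (j + 3)) := by
  obtain ⟨t, ht⟩ : ∃ t : ZMod 5 → ℂ, ∀ j, t j = (K j - C (j + 4)) / (C (j + 3) - K j) :=
    ⟨_, fun _ => rfl⟩
  have hsq : ∀ i, t i ^ 2 * C (i + 3) = C (i + 4) := fun i => by
    rw [ht]
    exact (S.ratio_sq i).1
  rw [← ht]
  refine ratio_eq_of_cyclic_system S.K_ne_zero S.C_ne_zero hsq (fun i => ?_) j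
  have e : ∀ i, t i * (C (i + 3) - K i) = K i - C (i + 4) := by
    intro i
    have hC := S.C_ne_K (i + 3)
    simp only [add_assoc, zmod_five_add, add_zero] at hC
    rw [ht]
    exact div_mul_cancel₀ _ (sub_ne_zero.2 hC)
  have hl := S.left_relation i
  have hr := S.right_relation i
  have e0 := e i
  have e1 := e (i + 1)
  have e4 := e (i + 4)
  have c0 := S.C_ne_K (i + 3)
  have c1 := S.C_ne_K (i + 4)
  have c4 := S.C_ne_K (i + 2)
  have q0 := hsq i
  have q1 := hsq (i + 1)
  have q4 := hsq (i + 4)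
  have n0 := S.C_ne_zero i
  have n2 := S.C_ne_zero (i + 2)
  simp only [add_assoc, zmod_five_add, add_zero] at hl hr e0 e1 e4 c0 c1 c4 q0 q1 q4 ⊢
  have c0' := sub_ne_zero.2 c0
  have c1' := sub_ne_zero.2 c1
  have c4' := sub_ne_zero.2 c4
  -- Both formulas for `B i` rewritten in the ratios; `h1` below eliminates `B i`.
  have hl' : (B i - K i) * t (i + 4) * C (i + 2) = K (i + 3) * (K i - C (i + 3)) := by
    apply mul_right_cancel₀ c4'
    linear_combination hl + (B i - K i) * C (i + 2) * e4
  have hr' : (B i - K i) * C i = K (i + 2) * (K i - C (i + 4)) * t (i + 1) := by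
    apply mul_right_cancel₀ c1'
    linear_combination -hr - K (i + 2) * (K i - C (i + 4)) * e1
  have hC : C i = (t (i + 4) * t i * t (i + 1)) ^ 2 * C (i + 2) := by
    linear_combination -q1 - t (i + 1) ^ 2 * q0 - t (i + 1) ^ 2 * t i ^ 2 * q4
  have hτ : t (i + 4) * t i * t (i + 1) ≠ 0 := by
    intro h
    rw [h] at hC
    exact n0 (by rw [hC]; ring)
  have h1 : -K (i + 3) * C i = K (i + 2) * (t (i + 4) * t i * t (i + 1)) * C (i + 2) := by
    apply mul_right_cancel₀ c0'
    linear_combination t (i + 4) * C (i + 2) * hr' - C i * hl' -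
      K (i + 2) * t (i + 1) * t (i + 4) * C (i + 2) * e0
  apply mul_right_cancel₀ (mul_ne_zero hτ n2)
  linear_combination -h1 - K (i + 3) * hC

theorem K_mul_ne (i : ZMod 5) : K i * K (i + 2) - K (i + 1) * K (i + 3) ≠ 0 := by
  have h := S.K_ne' (i + 1)
  simp only [add_assoc, zmod_five_add] at h
  exact (chord_intersection (S.conj_K _) (S.conj_K _) (S.conj_K _) (S.conj_K _) (S.K_ne_zero _)
    (S.K_ne_zero _) (S.K_ne_zero _) (S.K_ne_zero _) (S.K_ne' i) h (S.D_left i) (S.D_right i)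
    (S.KK_not_para i)).1

theorem D_mul (i : ZMod 5) : D i * (K i * K (i + 2) - K (i + 1) * K (i + 3)) =
    K i * K (i + 2) * (K (i + 1) + K (i + 3)) - K (i + 1) * K (i + 3) * (K i + K (i + 2)) := by
  have h := S.K_ne' (i + 1)
  simp only [add_assoc, zmod_five_add] at h
  exact (chord_intersection (S.conj_K _) (S.conj_K _) (S.conj_K _) (S.conj_K _) (S.K_ne_zero _)
    (S.K_ne_zero _) (S.K_ne_zero _) (S.K_ne_zero _) (S.K_ne' i) h (S.D_left i) (S.D_right i)
    (S.KK_not_para i)).2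

/-- The alternative value -1 would make the chords `K (j+1) K (j+3)` and `K (j+2) K (j+4)` parallel,
but they meet in `D (j+1)`. -/
theorem ratio_mul_C (j : ZMod 5) :
    (K j - C (j + 4)) / (C (j + 3) - K j) * C (j + 3) = K j := by
  refine (S.ratio_sq j).2.resolve_left fun h => ?_
  have hm := S.ratio_mul j
  rw [h] at hm
  have := S.K_mul_ne (j + 1)
  simp only [add_assoc, zmod_five_add] at this
  exact this (by linear_combination hm)

theorem C_eq (j : ZMod 5) :
    C j = -(K (j + 1) * K (j + 2) * K (j + 4)) / (K j * K (j + 3)) := by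
  have hm := S.ratio_mul (j + 2)
  have hc := S.ratio_mul_C (j + 2)
  simp only [add_assoc, zmod_five_add, add_zero] at hm hc
  rw [eq_div_iff (mul_ne_zero (S.K_ne_zero _) (S.K_ne_zero _))]
  have h : K (j + 2) * (K (j + 4) * K (j + 1)) = -(K (j + 3) * K j) * C j := by
    linear_combination C j * hm - K (j + 4) * K (j + 1) * hc
  linear_combination h

theorem C_mul_C (j : ZMod 5) : C (j + 3) * C (j + 2) = K (j + 4) ^ 2 := by
  have h1 := S.C_eq (j + 3)
  have h2 := S.C_eq (j + 2)
  simp only [add_assoc, zmod_five_add, add_zero] at h1 h2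
  have := S.K_ne_zero
  rw [h1, h2]
  have n0 := this j
  have n1 := this (j + 1)
  have n2 := this (j + 2)
  have n3 := this (j + 3)
  have n4 := this (j + 4)
  field_simp

theorem B_eq (j : ZMod 5) :
    B j = K j + K (j + 3) * K j / K (j + 4) + K j * K (j + 2) / K (j + 1) := by
  have hC := S.C_eq (j + 3)
  have hn := S.C_ne_K (j + 2)
  simp only [add_assoc, zmod_five_add, add_zero] at hC hn
  exact star_vertex_eq (S.K_ne_zero _) (S.K_ne_zero _) (S.K_ne_zero _) hC
    (S.C_mul_C j) hn (S.left_relation j)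

theorem L_eq (i : ZMod 5) : ∃ Δ : ℂ, Δ ≠ 0 ∧
    (L i - K i) * Δ = dirKL (K i) (K (i + 1)) (K (i + 2)) (K (i + 3)) (K (i + 4)) ∧
    conj (L i - K i) * (K i * Δ) =
      -dirKLConj (K i) (K (i + 1)) (K (i + 2)) (K (i + 3)) (K (i + 4)) := by
  have hc := S.C_eq (i + 1)
  have hb := S.B_eq (i + 2)
  have hb' := S.B_eq (i + 3)
  simp only [add_assoc, zmod_five_add, add_zero] at hc hb hb'
  exact ⟨_, second_centre_eq (S.conj_K _) (S.conj_K _) (S.conj_K _) (S.conj_K _) (S.conj_K _)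
    (S.K_ne_zero _) (S.K_ne_zero _) (S.K_ne_zero _) (S.K_ne_zero _) (S.K_ne_zero _)
    (by rw [hc]; ring) (by rw [hb]; ring) (by rw [hb']; ring) (S.CBB_triangle i)
    (S.L_circle i) (S.L_circle' i)⟩

theorem P_eq (i : ZMod 5) : P i = K (i + 2) + K i * K (i + 2) * K (i + 4) *
    (K (i + 2) - K (i + 1)) * (K (i + 2) - K (i + 3)) /
      ((K i * K (i + 2) - K (i + 1) * K (i + 3)) *
        (K (i + 1) * K (i + 3) - K (i + 2) * K (i + 4))) := by
  have hm := S.K_mul_ne (i + 1)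
  have hd := S.D_mul (i + 1)
  have h04 := S.K_ne (i + 2)
  have h12 := S.K_ne (i + 4)
  have h23 := S.K_ne i
  simp only [add_assoc, zmod_five_add, add_zero] at hm hd h04 h12 h23
  exact pentagram_circumcentre (S.conj_K _) (S.conj_K _) (S.conj_K _) (S.conj_K _) (S.conj_K _)
    (S.K_ne_zero _) (S.K_ne_zero _) (S.K_ne_zero _) (S.K_ne_zero _) (S.K_ne_zero _) h04
    (S.K_mul_ne i) hm rfl rfl (S.D_mul i) hd h12.symm h23.symm (S.D_circle i) (S.D_circle_succ i)

theorem E_eq (i : ZMod 5) :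
    dirKL (K i) (K (i + 1)) (K (i + 2)) (K (i + 3)) (K (i + 4)) ≠ 0 ∧
    dirKLConj (K i) (K (i + 1)) (K (i + 2)) (K (i + 3)) (K (i + 4)) ≠ 0 ∧
    (E i - K i) * dirKLConj (K i) (K (i + 1)) (K (i + 2)) (K (i + 3)) (K (i + 4)) =
      (K (i + 1) * K (i + 3) - K (i + 2) * K (i + 4)) * (K i - K (i + 2)) *
        (K i - K (i + 3)) := by
  have hm₁ := S.K_mul_ne (i + 1)
  have hm₂ := S.K_mul_ne (i + 2)
  have hd := S.D_mul (i + 1)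
  have h23 := S.K_ne i
  have hP := S.P_eq (i + 1)
  simp only [add_assoc, zmod_five_add, add_zero] at hm₁ hm₂ hd h23 hP
  exact pentagram_miquel_point (S.conj_K _) (S.conj_K _) (S.conj_K _) (S.conj_K _) (S.conj_K _)
    (S.K_ne_zero _) (S.K_ne_zero _) (S.K_ne_zero _) (S.K_ne_zero _) (S.K_ne_zero _)
    (S.K_mul_ne i) hm₁ hm₂ rfl rfl rfl h23.symm hd (S.P_eq i) hP
    (S.P_ne i) (S.E_reflection i)

end StarConfiguration

/-! ### Polynomials for the common point and the power of the inversion -/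

/-- Denominator of the common point of the lines `K L`. -/
def commonDen (k₀ k₁ k₂ k₃ k₄ : ℂ) : ℂ :=
  k₀ ^ 2 * k₂ ^ 2 * (k₄ - k₃) + k₁ ^ 2 * k₃ ^ 2 * (k₀ - k₄) + k₂ ^ 2 * k₄ ^ 2 * (k₁ - k₀)
    + k₃ ^ 2 * k₀ ^ 2 * (k₂ - k₁) + k₄ ^ 2 * k₁ ^ 2 * (k₃ - k₂)

/-- Numerator of the common point of the lines `K L`. -/
def commonNum (k₀ k₁ k₂ k₃ k₄ : ℂ) : ℂ :=
  k₀ ^ 2 * k₂ ^ 2 * k₁ * (k₄ - k₃) + k₁ ^ 2 * k₃ ^ 2 * k₂ * (k₀ - k₄)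
    + k₂ ^ 2 * k₄ ^ 2 * k₃ * (k₁ - k₀) + k₃ ^ 2 * k₀ ^ 2 * k₄ * (k₂ - k₁)
    + k₄ ^ 2 * k₁ ^ 2 * k₀ * (k₃ - k₂)

/-- Numerator of the conjugate of the common point of the lines `K L`. -/
def commonNumConj (k₀ k₁ k₂ k₃ k₄ : ℂ) : ℂ :=
  k₀ ^ 2 * (k₂ * k₄ - k₁ * k₃) + k₁ ^ 2 * (k₃ * k₀ - k₂ * k₄) + k₂ ^ 2 * (k₄ * k₁ - k₃ * k₀)
    + k₃ ^ 2 * (k₀ * k₂ - k₄ * k₁) + k₄ ^ 2 * (k₁ * k₃ - k₀ * k₂)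

/-- Numerator of the power of the inversion, centred at the common point of the lines `K L`, that
takes the points `K` to the points `E`. -/
def powerNum (k₀ k₁ k₂ k₃ k₄ : ℂ) : ℂ :=
  -((k₀ - k₁) * (k₁ - k₂) * (k₂ - k₃) * (k₃ - k₄) * (k₄ - k₀) *
    (k₀ ^ 2 * k₂ * k₃ * (k₁ - k₄) + k₁ ^ 2 * k₃ * k₄ * (k₂ - k₀) + k₂ ^ 2 * k₄ * k₀ * (k₃ - k₁)
      + k₃ ^ 2 * k₀ * k₁ * (k₄ - k₂) + k₄ ^ 2 * k₁ * k₂ * (k₀ - k₃)))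

/-- Places `X = commonNum / commonDen` on the line through `k₀`; `commonDen_sub_mul` is the
conjugate counterpart. -/
theorem commonDen_mul_sub (k₀ k₁ k₂ k₃ k₄ : ℂ) :
    k₀ * commonDen k₀ k₁ k₂ k₃ k₄ - commonNum k₀ k₁ k₂ k₃ k₄ =
      (k₀ - k₁) * (k₀ - k₄) * dirKL k₀ k₁ k₂ k₃ k₄ := by
  rw [commonDen, commonNum, dirKL]; ring

theorem commonDen_sub_mul (k₀ k₁ k₂ k₃ k₄ : ℂ) :
    commonDen k₀ k₁ k₂ k₃ k₄ - k₀ * commonNumConj k₀ k₁ k₂ k₃ k₄ =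
      -((k₀ - k₁) * (k₀ - k₄) * dirKLConj k₀ k₁ k₂ k₃ k₄) := by
  rw [commonDen, commonNumConj, dirKLConj]; ring

/-- A determinant of the directions of two of the lines: if `commonDen` vanishes, they are parallel.
-/
theorem dirKL_det (k₀ k₁ k₂ k₃ k₄ : ℂ) :
    dirKLConj k₀ k₁ k₂ k₃ k₄ * (k₂ * dirKL k₂ k₃ k₄ k₀ k₁) -
      dirKLConj k₂ k₃ k₄ k₀ k₁ * (k₀ * dirKL k₀ k₁ k₂ k₃ k₄) =
      (k₀ - k₂) * (k₂ * k₄ - k₃ * k₀) * commonDen k₀ k₁ k₂ k₃ k₄ := by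
  simp only [commonDen, dirKL, dirKLConj]; ring

/-- This is `(e - X) * (k₀⁻¹ - conj X) = powerNum / commonDen ^ 2` with denominators cleared. -/
theorem inversion_relation {k₀ k₁ k₂ k₃ k₄ e : ℂ}
    (he : (e - k₀) * dirKLConj k₀ k₁ k₂ k₃ k₄ =
      (k₁ * k₃ - k₂ * k₄) * (k₀ - k₂) * (k₀ - k₃)) :
    (e * commonDen k₀ k₁ k₂ k₃ k₄ - commonNum k₀ k₁ k₂ k₃ k₄) *
      (commonDen k₀ k₁ k₂ k₃ k₄ - k₀ * commonNumConj k₀ k₁ k₂ k₃ k₄) =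
      k₀ * powerNum k₀ k₁ k₂ k₃ k₄ := by
  have h1 : dirKLConj k₀ k₁ k₂ k₃ k₄ *
      (k₀ * commonDen k₀ k₁ k₂ k₃ k₄ - commonNum k₀ k₁ k₂ k₃ k₄) +
      (k₁ * k₃ - k₂ * k₄) * (k₀ - k₂) * (k₀ - k₃) * commonDen k₀ k₁ k₂ k₃ k₄ =
      -(k₀ * ((k₁ - k₂) * (k₂ - k₃) * (k₃ - k₄) *
    (k₀ ^ 2 * k₂ * k₃ * (k₁ - k₄) + k₁ ^ 2 * k₃ * k₄ * (k₂ - k₀) + k₂ ^ 2 * k₄ * k₀ * (k₃ - k₁)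
      + k₃ ^ 2 * k₀ * k₁ * (k₄ - k₂) + k₄ ^ 2 * k₁ * k₂ * (k₀ - k₃)))) := by
    rw [commonDen, commonNum, dirKLConj]; ring
  rw [commonDen_sub_mul, powerNum]
  linear_combination -(k₀ - k₁) * (k₀ - k₄) * (h1 + commonDen k₀ k₁ k₂ k₃ k₄ * he)

section unit
variable {k₀ k₁ k₂ k₃ k₄ : ℂ}
    (h0 : conj k₀ = k₀⁻¹) (h1 : conj k₁ = k₁⁻¹) (h2 : conj k₂ = k₂⁻¹) (h3 : conj k₃ = k₃⁻¹)
    (h4 : conj k₄ = k₄⁻¹) (n0 : k₀ ≠ 0) (n1 : k₁ ≠ 0) (n2 : k₂ ≠ 0) (n3 : k₃ ≠ 0) (n4 : k₄ ≠ 0)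
include h0 h1 h2 h3 h4 n0 n1 n2 n3 n4

theorem conj_commonDen : conj (commonDen k₀ k₁ k₂ k₃ k₄) * (k₀ * k₁ * k₂ * k₃ * k₄) ^ 2 =
    -commonDen k₀ k₁ k₂ k₃ k₄ := by
  simp only [commonDen, map_sub, map_add, map_mul, map_pow, h0, h1, h2, h3, h4]
  field_simp
  ring

theorem conj_commonNum : conj (commonNum k₀ k₁ k₂ k₃ k₄) * (k₀ * k₁ * k₂ * k₃ * k₄) ^ 2 =
    -commonNumConj k₀ k₁ k₂ k₃ k₄ := by
  simp only [commonNum, commonNumConj, map_sub, map_add, map_mul, map_pow, h0, h1, h2, h3, h4]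
  field_simp
  ring

theorem conj_powerNum : conj (powerNum k₀ k₁ k₂ k₃ k₄) * (k₀ * k₁ * k₂ * k₃ * k₄) ^ 4 =
    powerNum k₀ k₁ k₂ k₃ k₄ := by
  simp only [powerNum, map_neg, map_sub, map_add, map_mul, map_pow, h0, h1, h2, h3, h4]
  field_simp
  ring

theorem conj_commonNum_div_commonDen (hW : commonDen k₀ k₁ k₂ k₃ k₄ ≠ 0) :
    conj (commonNum k₀ k₁ k₂ k₃ k₄ / commonDen k₀ k₁ k₂ k₃ k₄) =
      commonNumConj k₀ k₁ k₂ k₃ k₄ / commonDen k₀ k₁ k₂ k₃ k₄ := by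
  have hW' : conj (commonDen k₀ k₁ k₂ k₃ k₄) ≠ 0 := (map_ne_zero _).2 hW
  have hp : (k₀ * k₁ * k₂ * k₃ * k₄) ^ 2 ≠ 0 := by positivity
  rw [map_div₀, div_eq_div_iff hW' hW]
  apply mul_right_cancel₀ hp
  linear_combination commonDen k₀ k₁ k₂ k₃ k₄ * conj_commonNum h0 h1 h2 h3 h4 n0 n1 n2 n3 n4 -
    commonNumConj k₀ k₁ k₂ k₃ k₄ * conj_commonDen h0 h1 h2 h3 h4 n0 n1 n2 n3 n4

theorem conj_powerNum_div (hW : commonDen k₀ k₁ k₂ k₃ k₄ ≠ 0) :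
    conj (powerNum k₀ k₁ k₂ k₃ k₄ / commonDen k₀ k₁ k₂ k₃ k₄ ^ 2) =
      powerNum k₀ k₁ k₂ k₃ k₄ / commonDen k₀ k₁ k₂ k₃ k₄ ^ 2 := by
  have hW' : conj (commonDen k₀ k₁ k₂ k₃ k₄) ≠ 0 := (map_ne_zero _).2 hW
  have hp : (k₀ * k₁ * k₂ * k₃ * k₄) ^ 4 ≠ 0 := by positivity
  have hd := conj_commonDen h0 h1 h2 h3 h4 n0 n1 n2 n3 n4
  rw [map_div₀, map_pow, div_eq_div_iff (pow_ne_zero _ hW') (pow_ne_zero _ hW)]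
  apply mul_right_cancel₀ hp
  linear_combination commonDen k₀ k₁ k₂ k₃ k₄ ^ 2 * conj_powerNum h0 h1 h2 h3 h4 n0 n1 n2 n3 n4 -
    powerNum k₀ k₁ k₂ k₃ k₄ * (conj (commonDen k₀ k₁ k₂ k₃ k₄) * (k₀ * k₁ * k₂ * k₃ * k₄) ^ 2 -
      commonDen k₀ k₁ k₂ k₃ k₄) * hd

end unit

/-! ### Images of the unit circle under inversion -/

/-- An inversion whose centre `X` is not on the unit circle takes the unit circle to a circle. -/
theorem inversion_unit_circle {X p k e : ℂ} (hp : conj p = p) (hk : conj k = k⁻¹) (k0 : k ≠ 0)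
    (hX : X * conj X ≠ 1) (h : (e - X) * (k⁻¹ - conj X) = p) :
    (e - (X - p / (X * conj X - 1) * X)) * conj (e - (X - p / (X * conj X - 1) * X)) =
      p ^ 2 / (X * conj X - 1) ^ 2 := by
  have hX' : X * conj X - 1 ≠ 0 := sub_ne_zero.2 hX
  have hX'' : conj X * X - 1 ≠ 0 := by rwa [mul_comm]
  have h1 : 1 - k * conj X ≠ 0 := by
    intro h
    have h2 := congrArg conj h
    simp only [map_sub, map_mul, map_one, map_zero, Complex.conj_conj, hk] at h2
    have : X = k := by
      field_simp at h2
      linear_combination -h2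
    rw [this, hk, mul_inv_cancel₀ k0] at hX
    exact hX rfl
  -- Here `X - k` and `1 - k * conj X` have equal modulus because `k` is unimodular, so the distance
  -- to the new centre does not depend on `k`.
  have e1 : e - (X - p / (X * conj X - 1) * X) =
      p * (X - k) / ((1 - k * conj X) * (X * conj X - 1)) := by
    have : e - X = p * k / (1 - k * conj X) := by
      rw [eq_div_iff h1, ← h]
      field_simp
    rw [← sub_add, this]
    field_simp
    ring
  have h3 : k - X ≠ 0 := by
    intro h
    rw [← sub_eq_zero.1 h, hk, mul_inv_cancel₀ k0] at hX
    exact hX rfl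
  rw [e1]
  simp only [map_div₀, map_mul, map_sub, map_one, Complex.conj_conj, hp, hk]
  have h4 : 1 - k⁻¹ * X = (k - X) / k := by field_simp
  have h5 : conj X - k⁻¹ = -(1 - k * conj X) / k := by field_simp; ring
  rw [h4, h5]
  field_simp
  ring

/-- An inversion whose centre `X` is on the unit circle takes the unit circle to a line. -/
theorem inversion_unit_circle_of_mem {X p k e : ℂ} (hp : conj p = p) (hk : conj k = k⁻¹)
    (k0 : k ≠ 0) (hX : X * conj X = 1) (hkX : k ≠ X) (h : (e - X) * (k⁻¹ - conj X) = p) :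
    e + X ^ 2 * conj e = (2 - p) * X := by
  have X0 : X ≠ 0 := by rintro rfl; simp at hX
  have hX' : conj X = X⁻¹ := eq_inv_of_mul_eq_one_right hX
  have h2 := congrArg conj h
  simp only [map_sub, map_mul, map_inv₀, hp, hk, hX', inv_inv] at h h2
  have h3 := sub_ne_zero.2 hkX
  apply mul_right_cancel₀ h3
  field_simp at h h2
  linear_combination -h + X * h2

/-! ### Collinearity, and the inversion taking `K` to `E` -/

namespace StarConfiguration
variable {A B C D E K L P : ZMod 5 → ℂ} (S : StarConfiguration A B C D E K L P)
include S

theorem para_K_L_E (i : ZMod 5) : Para (L i - K i) (E i - K i) := by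
  obtain ⟨Δ, hΔ, h1, h2⟩ := S.L_eq i
  obtain ⟨hH, hG, hE⟩ := S.E_eq i
  have c0 := S.conj_K i
  have c1 := S.conj_K (i + 1)
  have c2 := S.conj_K (i + 2)
  have c3 := S.conj_K (i + 3)
  have c4 := S.conj_K (i + 4)
  have n0 := S.K_ne_zero i
  have n1 := S.K_ne_zero (i + 1)
  have n2 := S.K_ne_zero (i + 2)
  have n3 := S.K_ne_zero (i + 3)
  have n4 := S.K_ne_zero (i + 4)
  generalize K (i + 1) = k₁ at *
  generalize K (i + 2) = k₂ at *
  generalize K (i + 3) = k₃ at *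
  generalize K (i + 4) = k₄ at *
  generalize K i = k₀ at *
  have hc := conj_dirKL c0 c1 c2 c3 c4 n0 n1 n2 n3 n4
  have hE' := congrArg conj hE
  rw [map_mul, ← hc] at hE'
  simp only [map_mul, map_pow, Complex.conj_conj] at hE'
  have e1 : conj (E i - k₀) * (k₀ * dirKL k₀ k₁ k₂ k₃ k₄) =
      -((k₁ * k₃ - k₂ * k₄) * (k₀ - k₂) * (k₀ - k₃)) := by
    simp only [map_sub, map_mul, c0, c1, c2, c3, c4] at hE' ⊢
    field_simp at hE'
    linear_combination hE' - dirKL k₀ k₁ k₂ k₃ k₄ * mul_inv_cancel₀ n0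
  unfold Para
  have hn : Δ * k₀ * (dirKL k₀ k₁ k₂ k₃ k₄ * dirKLConj k₀ k₁ k₂ k₃ k₄) ≠ 0 := by positivity
  apply mul_right_cancel₀ hn
  linear_combination conj (E i - k₀) * k₀ * dirKL k₀ k₁ k₂ k₃ k₄ * dirKLConj k₀ k₁ k₂ k₃ k₄ * h1 +
    dirKL k₀ k₁ k₂ k₃ k₄ * dirKLConj k₀ k₁ k₂ k₃ k₄ * e1 -
    (E i - k₀) * dirKL k₀ k₁ k₂ k₃ k₄ * dirKLConj k₀ k₁ k₂ k₃ k₄ * h2 +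
    dirKL k₀ k₁ k₂ k₃ k₄ * dirKLConj k₀ k₁ k₂ k₃ k₄ * hE

/-- `-ρ i` is the quotient of `L i - K i` by its conjugate, so it encodes the direction of the line.
A zero `commonDen` gives `ρ i = ρ (i + 2)`, and 2 generates `ZMod 5`. -/
theorem commonDen_ne_zero {i j : ZMod 5} (h : ¬ Para (L i - K i) (L j - K j)) :
    commonDen (K 0) (K 1) (K 2) (K 3) (K 4) ≠ 0 := by
  intro hW
  apply h
  obtain ⟨ρ, hρ⟩ : ∃ ρ : ZMod 5 → ℂ, ∀ i, ρ i = K i *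
      dirKL (K i) (K (i + 1)) (K (i + 2)) (K (i + 3)) (K (i + 4)) /
      dirKLConj (K i) (K (i + 1)) (K (i + 2)) (K (i + 3)) (K (i + 4)) := ⟨_, fun _ => rfl⟩
  have hW' : ∀ i, commonDen (K i) (K (i + 1)) (K (i + 2)) (K (i + 3)) (K (i + 4)) = 0 := by
    rw [forall_zmod_five]
    simp only [zmod_five_add, zero_add]
    unfold commonDen at *
    refine ⟨?_, ?_, ?_, ?_, ?_⟩ <;> linear_combination hW
  have step : ∀ i, ρ i = ρ (i + 2) := by
    intro i
    have hd := dirKL_det (K i) (K (i + 1)) (K (i + 2)) (K (i + 3)) (K (i + 4))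
    have g0 := (S.E_eq i).2.1
    have g2 := (S.E_eq (i + 2)).2.1
    have r2 := hρ (i + 2)
    simp only [add_assoc, zmod_five_add, add_zero] at g2 r2
    rw [hρ i, r2, div_eq_div_iff g0 g2]
    linear_combination -hd - (K i - K (i + 2)) * (K (i + 2) * K (i + 4) - K (i + 3) * K i) * hW' i
  have hρ0 : ∀ i, ρ i = ρ 0 := by
    rw [forall_zmod_five] at step ⊢
    simp only [zmod_five_add, zero_add] at step
    obtain ⟨h0, h1, h2, h3, h4⟩ := step
    exact ⟨rfl, by rw [h0, h2, h4], h0.symm, by rw [h0, h2, h4, h1], by rw [h0, h2]⟩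
  have key : ∀ i, L i - K i = -ρ 0 * conj (L i - K i) := by
    intro i
    obtain ⟨Δ, hΔ, h1, h2⟩ := S.L_eq i
    have g0 := (S.E_eq i).2.1
    have hr : ρ 0 * dirKLConj (K i) (K (i + 1)) (K (i + 2)) (K (i + 3)) (K (i + 4)) =
        K i * dirKL (K i) (K (i + 1)) (K (i + 2)) (K (i + 3)) (K (i + 4)) := by
      rw [← hρ0 i, hρ i, div_mul_cancel₀ _ g0]
    apply mul_right_cancel₀ (mul_ne_zero (S.K_ne_zero i) hΔ)
    linear_combination K i * h1 + ρ 0 * h2 - hr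
  unfold Para
  linear_combination conj (L j - K j) * key i - conj (L i - K i) * key j

theorem exists_inversion {i j : ZMod 5} (h : ¬ Para (L i - K i) (L j - K j)) :
    ∃ X p : ℂ, conj p = p ∧ (∀ i, Para (X - K i) (L i - K i)) ∧
      ∀ i, (E i - X) * ((K i)⁻¹ - conj X) = p := by
  have hW := S.commonDen_ne_zero h
  have hX := conj_commonNum_div_commonDen (S.conj_K 0) (S.conj_K 1) (S.conj_K 2) (S.conj_K 3)
    (S.conj_K 4) (S.K_ne_zero 0) (S.K_ne_zero 1) (S.K_ne_zero 2) (S.K_ne_zero 3) (S.K_ne_zero 4) hW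
  have hp := conj_powerNum_div (S.conj_K 0) (S.conj_K 1) (S.conj_K 2) (S.conj_K 3)
    (S.conj_K 4) (S.K_ne_zero 0) (S.K_ne_zero 1) (S.K_ne_zero 2) (S.K_ne_zero 3) (S.K_ne_zero 4) hW
  -- All four polynomials are cyclically invariant, so the same `X` and `p` serve every index.
  have cW : ∀ i, commonDen (K i) (K (i + 1)) (K (i + 2)) (K (i + 3)) (K (i + 4)) =
      commonDen (K 0) (K 1) (K 2) (K 3) (K 4) := by
    rw [forall_zmod_five]
    simp only [zmod_five_add, zero_add, commonDen]
    refine ⟨trivial, ?_, ?_, ?_, ?_⟩ <;> ring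
  have cU : ∀ i, commonNum (K i) (K (i + 1)) (K (i + 2)) (K (i + 3)) (K (i + 4)) =
      commonNum (K 0) (K 1) (K 2) (K 3) (K 4) := by
    rw [forall_zmod_five]
    simp only [zmod_five_add, zero_add, commonNum]
    refine ⟨trivial, ?_, ?_, ?_, ?_⟩ <;> ring
  have cV : ∀ i, commonNumConj (K i) (K (i + 1)) (K (i + 2)) (K (i + 3)) (K (i + 4)) =
      commonNumConj (K 0) (K 1) (K 2) (K 3) (K 4) := by
    rw [forall_zmod_five]
    simp only [zmod_five_add, zero_add, commonNumConj]
    refine ⟨trivial, ?_, ?_, ?_, ?_⟩ <;> ring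
  have cQ : ∀ i, powerNum (K i) (K (i + 1)) (K (i + 2)) (K (i + 3)) (K (i + 4)) =
      powerNum (K 0) (K 1) (K 2) (K 3) (K 4) := by
    rw [forall_zmod_five]
    simp only [zmod_five_add, zero_add, powerNum]
    refine ⟨trivial, ?_, ?_, ?_, ?_⟩ <;> ring
  refine ⟨commonNum (K 0) (K 1) (K 2) (K 3) (K 4) / commonDen (K 0) (K 1) (K 2) (K 3) (K 4),
    _, hp, fun i => ?_, fun i => ?_⟩
  · obtain ⟨Δ, hΔ, h1, h2⟩ := S.L_eq i
    have m1 := commonDen_mul_sub (K i) (K (i + 1)) (K (i + 2)) (K (i + 3)) (K (i + 4))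
    have m2 := commonDen_sub_mul (K i) (K (i + 1)) (K (i + 2)) (K (i + 3)) (K (i + 4))
    rw [cW, cU] at m1
    rw [cW, cV] at m2
    have n0 := S.K_ne_zero i
    have e1 : (commonNum (K 0) (K 1) (K 2) (K 3) (K 4) / commonDen (K 0) (K 1) (K 2) (K 3) (K 4) -
        K i) * commonDen (K 0) (K 1) (K 2) (K 3) (K 4) = -((K i - K (i + 1)) * (K i - K (i + 4)) *
          dirKL (K i) (K (i + 1)) (K (i + 2)) (K (i + 3)) (K (i + 4))) := by
      rw [sub_mul, div_mul_cancel₀ _ hW, ← m1]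
      ring
    have e2 : conj (commonNum (K 0) (K 1) (K 2) (K 3) (K 4) /
        commonDen (K 0) (K 1) (K 2) (K 3) (K 4) - K i) *
          (K i * commonDen (K 0) (K 1) (K 2) (K 3) (K 4)) =
        (K i - K (i + 1)) * (K i - K (i + 4)) *
          dirKLConj (K i) (K (i + 1)) (K (i + 2)) (K (i + 3)) (K (i + 4)) := by
      rw [map_sub, hX, S.conj_K, ← neg_neg ((K i - K (i + 1)) * _ * _), ← m2]
      field_simp
      ring
    apply mul_right_cancel₀ (mul_ne_zero (mul_ne_zero n0 hΔ) hW)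
    linear_combination conj (L i - K i) * (K i * Δ) * e1 - (K i - K (i + 1)) * (K i - K (i + 4)) *
      dirKL (K i) (K (i + 1)) (K (i + 2)) (K (i + 3)) (K (i + 4)) * h2 - (L i - K i) * Δ * e2 -
      (K i - K (i + 1)) * (K i - K (i + 4)) *
      dirKLConj (K i) (K (i + 1)) (K (i + 2)) (K (i + 3)) (K (i + 4)) * h1
  · have hr := inversion_relation (S.E_eq i).2.2
    rw [cW, cU, cV, cQ] at hr
    have n0 := S.K_ne_zero i
    rw [hX]
    field_simp
    linear_combination hr

end StarConfiguration

/-! ### Return to the Euclidean plane -/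

theorem conj_eq_inv_of_mem_sphere {O : Sphere Plane} {f : Plane ≃ᵃ[ℝ] ℂ} (hr : 0 < O.radius)
    (h0 : f O.center = 0) (hf : ∀ p q, dist (f p) (f q) = O.radius⁻¹ * dist p q) {p : Plane}
    (hp : p ∈ O) : conj (f p) = (f p)⁻¹ ∧ f p ≠ 0 := by
  have h1 : ‖f p‖ = 1 := by
    rw [← dist_zero_right, ← h0, hf, mem_sphere.1 hp, inv_mul_cancel₀ hr.ne']
  have h2 : f p * conj (f p) = 1 := by
    rw [Complex.mul_conj, Complex.normSq_eq_norm_sq, h1]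
    simp
  have h3 : f p ≠ 0 := by
    intro h
    rw [h] at h2
    simp at h2
  exact ⟨eq_inv_of_mul_eq_one_right h2, h3⟩

theorem starConfiguration_of_circles {A B C D E K L : ZMod 5 → Plane}
    {k l d : ZMod 5 → Sphere Plane} {O : Sphere Plane} {f : Plane ≃ᵃ[ℝ] ℂ} (hr : 0 < O.radius)
    (h0 : f O.center = 0) (hf : ∀ p q, dist (f p) (f q) = O.radius⁻¹ * dist p q)
    (hB : ∀ i, IsLineIntersection (A i) (A (i + 1)) (A (i + 2)) (A (i + 3)) (B (i + 3)))
    (hk : ∀ i, IsCircle (k (i + 2)) (A i) (A (i + 1)) (B (i + 2)))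
    (hK : ∀ i, K i = (k i).center)
    (hC : ∀ i, IsSecondIntersection (k (i + 2)) (k (i + 3)) (A (i + 1)) (C (i + 1)))
    (hl : ∀ i, IsCircle (l i) (C (i + 1)) (B (i + 2)) (B (i + 3)))
    (hL : ∀ i, L i = (l i).center)
    (hOC : ∀ i, C i ∈ O)
    (hOK : ∀ i, K i ∈ O)
    (hD : ∀ i, IsLineIntersection (K i) (K (i + 2)) (K (i + 1)) (K (i + 3)) (D i))
    (hd : ∀ i, IsCircle (d i) (D i) (D (i + 1)) (K (i + 2)))
    (hE : ∀ i, IsSecondIntersection (d i) (d (i + 1)) (D (i + 1)) (E i)) :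
    StarConfiguration (fun i => f (A i)) (fun i => f (B i)) (fun i => f (C i)) (fun i => f (D i))
      (fun i => f (E i)) (fun i => f (K i)) (fun i => f (L i)) (fun i => f (d i).center) := by
  have hs : O.radius⁻¹ ≠ 0 := inv_ne_zero hr.ne'
  have hCl : ∀ i, C i ∈ k (i + 2) := by
    intro i
    have h : C (i + 4 + 1) ∈ (k (i + 4 + 2) : Set Plane) ∩ (k (i + 4 + 3) : Set Plane) :=
      (hC (i + 4)).symm.subset (by simp)
    simp only [add_assoc, zmod_five_add, add_zero] at h
    exact h.2
  have hCr : ∀ i, C (i + 1) ∈ k (i + 2) := by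
    intro i
    have h : C (i + 1) ∈ (k (i + 2) : Set Plane) ∩ (k (i + 3) : Set Plane) :=
      (hC i).symm.subset (by simp)
    exact h.1
  refine
  { conj_C := fun i => (conj_eq_inv_of_mem_sphere hr h0 hf (hOC i)).1
    conj_K := fun i => (conj_eq_inv_of_mem_sphere hr h0 hf (hOK i)).1
    C_ne_zero := fun i => (conj_eq_inv_of_mem_sphere hr h0 hf (hOC i)).2
    K_ne_zero := fun i => (conj_eq_inv_of_mem_sphere hr h0 hf (hOK i)).2
    A_ne := fun i => f.injective.ne (hB i).1
    B_left := fun i => (hB i).para_left f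
    B_right := fun i => (hB i).para_right f
    A_circle := fun i => by
      rw [hK]
      exact mul_conj_eq_of_mem hf (hk i).2.1 (hk i).2.2.1
    B_circle := fun i => by
      rw [hK]
      exact mul_conj_eq_of_mem hf (hk i).2.2.2 (hk i).2.1
    C_circle := fun i => by
      rw [hK]
      exact mul_conj_eq_of_mem hf (hCl i) (hk i).2.1
    C_circle_succ := fun i => by
      rw [hK]
      exact mul_conj_eq_of_mem hf (hCr i) (hk i).2.1
    ABA_triangle := fun i => (hk i).not_para f
    K_ne := fun i => by
      rw [hK, hK]
      exact f.injective.ne ((hC i).center_ne f (hk i))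
    C_reflection := fun i => by
      rw [hK, hK]
      exact (hC i).reflection hs hf ((hC i).center_ne f (hk i))
    L_circle := fun i => by
      rw [hL]
      exact mul_conj_eq_of_mem hf (hl i).2.1 (hl i).2.2.1
    L_circle' := fun i => by
      rw [hL]
      exact mul_conj_eq_of_mem hf (hl i).2.1 (hl i).2.2.2
    CBB_triangle := fun i => (hl i).not_para f
    K_ne' := fun i => f.injective.ne (hD i).1
    D_left := fun i => (hD i).para_left f
    D_right := fun i => (hD i).para_right f
    KK_not_para := fun i => (hD i).not_para f
    D_circle := fun i => mul_conj_eq_of_mem hf (hd i).2.2.2 (hd i).2.1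
    D_circle_succ := fun i => mul_conj_eq_of_mem hf (hd i).2.2.2 (hd i).2.2.1
    P_ne := fun i => f.injective.ne ((hE i).center_ne f (hd i))
    E_reflection := fun i => (hE i).reflection hs hf ((hE i).center_ne f (hd i)) }

theorem collinear_of_forall_mem_line {s : Set Plane} {a b : Plane}
    (h : ∀ p ∈ s, p ∈ line[ℝ, a, b]) : Collinear ℝ s := by
  refine Collinear.subset (s₂ := (line[ℝ, a, b] : Set Plane)) h ?_
  have hc := collinear_pair ℝ a b
  unfold Collinear at *
  rwa [← direction_affineSpan] at hc

/-- The images of points of the unit circle under an inversion centred on that circle lie on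
a line, also when the inversion degenerates to a constant map. -/
theorem collinear_range_of_inversion {K E : ZMod 5 → Plane} (f : Plane ≃ᵃ[ℝ] ℂ)
    (hK : Function.Injective K) {X p : ℂ} (hp : conj p = p) (hKu : ∀ i, conj (f (K i)) = (f (K i))⁻¹)
    (hK0 : ∀ i, f (K i) ≠ 0) (hX : X * conj X = 1)
    (h : ∀ i, (f (E i) - X) * ((f (K i))⁻¹ - conj X) = p) : Collinear ℝ (Set.range E) := by
  -- If some `K i` is the centre `X`, then `p = 0` and every other `E j` equals `X`.
  by_cases hm : ∃ i, f (K i) = X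
  · obtain ⟨i, hi⟩ := hm
    have hp0 : p = 0 := by
      rw [← h i, ← hi, hKu]
      ring
    apply (collinear_pair ℝ (E i) (f.symm X)).subset
    rintro _ ⟨j, rfl⟩
    by_cases hj : j = i
    · exact Or.inl (by rw [hj])
    · right
      have hne : (f (K j))⁻¹ - conj X ≠ 0 := by
        rw [← hKu, ← hi, ← map_sub]
        exact (map_ne_zero _).2 (sub_ne_zero.2 (f.injective.ne (hK.ne hj)))
      have := (mul_eq_zero.1 ((h j).trans hp0)).resolve_right hne
      rw [Set.mem_singleton_iff, ← sub_eq_zero.1 this, f.symm_apply_apply]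
  · push Not at hm
    have hl := fun i => inversion_unit_circle_of_mem hp (hKu i) (hK0 i) hX (hm i) (h i)
    have X0 : X ≠ 0 := by rintro rfl; simp at hX
    -- The image line is perpendicular to `X`, so `I * X` is a direction vector.
    obtain ⟨q, hq⟩ : ∃ q, f q = f (E 0) + Complex.I * X := ⟨_, f.apply_symm_apply _⟩
    have hne : E 0 ≠ q := by
      rintro rfl
      exact mul_ne_zero Complex.I_ne_zero X0 (by linear_combination -hq)
    apply collinear_of_forall_mem_line (a := E 0) (b := q)
    rintro _ ⟨i, rfl⟩
    rw [mem_line_iff_para f hne, hq]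
    unfold Para
    simp only [map_sub, map_add, map_mul, Complex.conj_I]
    linear_combination -(Complex.I * conj X) * (hl i - hl 0) +
      Complex.I * X * (conj (f (E i)) - conj (f (E 0))) * hX

theorem injective_of_ne_add {α : Type*} {K : ZMod 5 → α} (h1 : ∀ i, K (i + 1) ≠ K i)
    (h2 : ∀ i, K i ≠ K (i + 2)) : Function.Injective K := by
  have key : ∀ δ i, K i = K (i + δ) → δ = 0 := by
    rw [forall_zmod_five]
    refine ⟨fun _ _ => rfl, fun i h => ?_, fun i h => ?_, fun i h => ?_, fun i h => ?_⟩ <;> exfalso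
    · exact h1 i h.symm
    · exact h2 i h
    · have := h2 (i + 3)
      simp only [add_assoc, zmod_five_add, add_zero] at this
      exact this h.symm
    · have := h1 (i + 4)
      simp only [add_assoc, zmod_five_add, add_zero] at this
      exact this h
  intro i j hij
  have := key (j - i) i (by rwa [add_sub_cancel])
  exact (sub_eq_zero.1 this).symm

theorem theorem8
    -- the points of the configuration, with subscripts modulo 5
    (A B C D E K L : ZMod 5 → Plane)
    -- the circles centred at `K i`, the circles centred at `L i`, the circles about `D i`, and `(O)`
    (k l d : ZMod 5 → EuclideanGeometry.Sphere Plane)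
    (O : EuclideanGeometry.Sphere Plane)
    (hB : ∀ i, IsLineIntersection (A i) (A (i + 1)) (A (i + 2)) (A (i + 3)) (B (i + 3)))
    (hk : ∀ i, IsCircle (k (i + 2)) (A i) (A (i + 1)) (B (i + 2)))
    (hK : ∀ i, K i = (k i).center)
    (hC : ∀ i, IsSecondIntersection (k (i + 2)) (k (i + 3)) (A (i + 1)) (C (i + 1)))
    (hl : ∀ i, IsCircle (l i) (C (i + 1)) (B (i + 2)) (B (i + 3)))
    (hL : ∀ i, L i = (l i).center)
    (hOC : ∀ i, C i ∈ O)
    (hOK : ∀ i, K i ∈ O)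
    (hD : ∀ i, IsLineIntersection (K i) (K (i + 2)) (K (i + 1)) (K (i + 3)) (D i))
    (hd : ∀ i, IsCircle (d i) (D i) (D (i + 1)) (K (i + 2)))
    (hE : ∀ i, IsSecondIntersection (d i) (d (i + 1)) (D (i + 1)) (E i)) :
    (∀ i, Collinear ℝ {K i, L i, E i}) ∧
    ( -- the points `E i` determine a circle, not a line or fewer than three points
      ¬ Collinear ℝ (Set.range E) →
      -- the lines `K i L i` are lines, and not all parallel
      (∀ i, K i ≠ L i) →
      (∃ i j, ¬ (line[ℝ, K i, L i]).Parallel (line[ℝ, K j, L j])) →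
      ∃ (J : EuclideanGeometry.Sphere Plane) (X : Plane),
        (∀ i, E i ∈ J) ∧ (∀ i, X ∈ line[ℝ, K i, L i]) ∧
        Collinear ℝ {O.center, J.center, X}) := by
  have hr : 0 < O.radius := by
    have hn : 0 ≤ O.radius := by
      rw [← mem_sphere.1 (hOK 0)]
      exact dist_nonneg
    refine lt_of_le_of_ne hn fun h => (hD 0).1 ?_
    have hc : ∀ i, K i = O.center := fun i => dist_eq_zero.1 ((mem_sphere.1 (hOK i)).trans h.symm)
    rw [hc, hc]
  obtain ⟨f, h0, hf⟩ := exists_affineEquiv_complex O.center hr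
  have S := starConfiguration_of_circles hr h0 hf hB hk hK hC hl hL hOC hOK hD hd hE
  refine ⟨fun i => (collinear_iff_para f).2 (S.para_K_L_E i), fun hcol hKL ⟨i, j, hij⟩ => ?_⟩
  have hnp : ¬ Para (f (L i) - f (K i)) (f (L j) - f (K j)) :=
    fun h => hij (parallel_of_para f (hKL i) (hKL j) h)
  obtain ⟨X, p, hp, hX, hinv⟩ := S.exists_inversion hnp
  have hinj : Function.Injective K := by
    refine injective_of_ne_add (fun i h => ?_) fun i => (hD i).1
    have := S.K_ne (i + 3)
    simp only [add_assoc, zmod_five_add, add_zero] at this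
    exact this (congrArg f h)
  have hX1 : X * conj X ≠ 1 := fun h1 =>
    hcol (collinear_range_of_inversion f hinj hp S.conj_K S.K_ne_zero h1 hinv)
  -- In the chart `O` is 0 and `J` is a real multiple of `X`, whence the last collinearity.
  obtain ⟨J, hJ⟩ : ∃ J, f J = X - p / (X * conj X - 1) * X := ⟨_, f.apply_symm_apply _⟩
  have hE' : ∀ i, (f (E i) - f J) * conj (f (E i) - f J) = p ^ 2 / (X * conj X - 1) ^ 2 := by
    intro i
    rw [hJ]
    exact inversion_unit_circle hp (S.conj_K i) (S.K_ne_zero i) hX1 (hinv i)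
  refine ⟨⟨J, dist (E 0) J⟩, f.symm X, fun i => ?_, fun i => ?_, ?_⟩
  · exact mem_of_mul_conj_eq (S := ⟨J, dist (E 0) J⟩) (inv_ne_zero hr.ne') hf
      (mem_sphere.2 rfl) ((hE' 0).trans (hE' i).symm)
  · rw [mem_line_iff_para f (hKL i), f.apply_symm_apply]
    exact hX i
  · rw [collinear_iff_para f, h0, f.apply_symm_apply, hJ, sub_zero, sub_zero]
    unfold Para
    simp only [map_sub, map_mul, map_div₀, map_one, Complex.conj_conj, hp]
    ring
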